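/- Conventions. Let $n>2$. Let $M^n$ be a smooth Hausdorff manifold which is the union of a compact set $W$ and of finitely many ends $\Omega_I$, each with coordinates $x^i$ identifying it with $\{r>r_0\}\subset\mathbb R^n$, $r=(\sum_i (x^i)^2)^{1/2}$, $r_0>0$; $W$ is covered by finitely many coordinate balls $W_K$ which do not meet $\{r>2r_0\}\subset\Omega_I$, and $f_I,f_K\ge 0$ is a smooth partition of unity with supports in $\Omega_I$, $W_K$ and $f_I=1$ for $r>2r_0$. On $\Omega_I$, $u\in H_{s,\delta}$ means that the weak derivatives $D^ku$, $0\le k\le s$ ($s$ an integer), satisfy $\int_{\Omega_I} r^{2(k+\delta)}|D^ku|^2dx<\infty$; $u\in C^k_\beta$ means that $u$ is $C^k$ and $r^{\beta+l}|D^lu|$ is bounded for $0\le l\le k$; $H_s$ on $W_K$ is the usual Sobolev space; a tensor $u$ on $\Omega_I$ belongs to such a space if the components of $f_Iu$ do. A continuous Riemannian metric $g$ on $M$ which is, in each $\Omega_I$ and $W_K$, bounded above and below by constant positive definite quadratic forms is called asymptotically Euclidean (A.E.) if, with $e=\sum_i(dx^i)^2$, $$f_I(g-e)\in H_{s,\delta}\cap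 C^1_{n-2},\quad f_Kg\in H_s,\qquad s>\tfrac n2+1,\quad \tfrac n2-2>\delta>-\tfrac n2 .$$ In an end $\Omega_I$ let $S_r=\{(\sum_i(x^i)^2)^{1/2}=r\}$, with $g$-unit conormal $n_i$ and volume element $\mu_{\bar g}$ induced by $g$; the mass of the end is $$m=\lim_{r\to\infty}\frac12\int_{S_r}(\partial_jg_{ij}-\partial_ig_{jj})\,n_i\,\mu_{\bar g}$$ (coordinate components). Let $\theta^j=a_i^jdx^i$ be any $g$-orthonormal coframe on $\Omega_I$ with $a_i^j=\delta_i^j+\frac12\lambda_i^j$, $\lambda_i^j\in H_{s,\delta}\cap C^1_{n-2}$, and $(e_i)$ the dual frame. Let $\gamma^i=\gamma_i$, $i=1,\dots,n$, be hermitian matrices of size $2^{[n/2]}$ with $\gamma_i\gamma_j+\gamma_j\gamma_i=2\eta_{ij}$, $\eta_{ij}=\delta_{ij}$, and let $\sigma_i=\frac14\gamma^h\gamma^k\omega_{i,hk}$ be the spin connection, where $d\theta^h=\frac12c^h_{ij}\theta^i\wedge\theta^j$ and $\omega_{i,jh}=\frac12(-c^i_{jh}+c^h_{ij}-c^j_{ih})=g(e_j,\nabla_{e_i}e_h)$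 is the Riemannian connection of $g$. Theorem (gravitational mass via the spin connection). Let $(M^n,g)$ be A.E. with $n>2$, and let $\psi_0$ be a spinor whose representative in the frame $(e_i)$ on the end $\Omega_I$ is constant, with $|\psi_0|^2=\tilde\psi_0\psi_0=1$ ($\tilde\psi_0$ is the conjugate transpose). Set $$\mathcal U_0^i=\mathrm{Re}\{\tilde\psi_0(\eta^{ij}-\gamma^i\gamma^j)\sigma_j\psi_0\}.$$ Then $$\lim_{r\to\infty}\int_{S_r}\mathcal U_0^i\,n_i\,\mu_{\bar g}=\frac m2$$ (components in the frame $e_i$, $\theta^i$), in the sense that for every real $m$ this limit exists and equals $m/2$ if and only if the mass of the end exists and equals $m$. Moreover both limits do exist when $g$ satisfies in the region $r>2r_0$ of $\Omega_I$ the Hamiltonian constraint $R-|K|^2+(\mathrm{tr}K)^2=2T_{00}$ (almost everywhere, the scalar curvature $R$ being computed with weak second derivatives) with a nonnegative energy density $T_{00}\ge0$ and a symmetric 2-tensor $K\in C^0_{n-1}$. -/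

import Mathlib

open Filter Topology MeasureTheory Matrix
open scoped Manifold ContDiff

/-! ### Coordinate space, partial derivatives, function spaces -/

/-- The Euclidean space `ℝⁿ` with coordinates `x i` and `r = ‖x‖`. -/
abbrev Coord (n : ℕ) : Type := EuclideanSpace ℝ (Fin n)

/-- The `k`-th coordinate vector. -/
noncomputable def coordVec {n : ℕ} (k : Fin n) : Coord n := EuclideanSpace.single k (1 : ℝ)

/-- The exterior domain `{x : r > R}`. -/
def exterior (n : ℕ) (R : ℝ) : Set (Coord n) := {x | R < ‖x‖}

/-- The partial derivative `∂u/∂xᵏ` at `x`. -/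
noncomputable def pderiv {n : ℕ} (k : Fin n) (u : Coord n → ℝ) (x : Coord n) : ℝ :=
  fderiv ℝ u x (coordVec k)

/-- `v` is the weak derivative `∂ᵏu / ∂x^{J 0} ⋯ ∂x^{J (k-1)}` of `u` on the open set `U`. -/
def IsWeakDeriv {n : ℕ} (U : Set (Coord n)) {k : ℕ} (J : Fin k → Fin n)
    (u v : Coord n → ℝ) : Prop :=
  LocallyIntegrableOn u U ∧ LocallyIntegrableOn v U ∧
    ∀ φ : Coord n → ℝ, ContDiff ℝ ∞ φ → HasCompactSupport φ → tsupport φ ⊆ U →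
      ∫ x in U, u x * iteratedFDeriv ℝ k φ x (fun a => coordVec (J a)) =
        (-1) ^ k * ∫ x in U, v x * φ x

/-- Weighted `L²` Sobolev space of order `s` on `U`: all weak derivatives of order `k ≤ s` exist
and are square integrable on `U` with the weight `w k`. -/
def MemSobolev {n : ℕ} (U : Set (Coord n)) (w : ℕ → Coord n → ℝ) (s : ℕ)
    (u : Coord n → ℝ) : Prop :=
  ∀ k : ℕ, k ≤ s → ∀ J : Fin k → Fin n, ∃ v : Coord n → ℝ,
    IsWeakDeriv U J u v ∧ IntegrableOn (fun x => w k x * v x ^ 2) U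

/-- The unweighted Sobolev space `H_s` on `U`. -/
def MemHs {n : ℕ} (U : Set (Coord n)) (s : ℕ) (u : Coord n → ℝ) : Prop :=
  MemSobolev U (fun _ _ => 1) s u

/-- The weighted Sobolev space `H_{s,δ}` on `U`, with weights `r^{2(k+δ)}`. -/
def MemHsδ {n : ℕ} (U : Set (Coord n)) (s : ℕ) (δ : ℝ) (u : Coord n → ℝ) : Prop :=
  MemSobolev U (fun k x => ‖x‖ ^ (2 * ((k : ℝ) + δ))) s u

/-- The weighted space `C^k_β` on `U`: `u` is `C^k` and `r^{β+l} |Dˡu|` is bounded, `l ≤ k`. -/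
def MemCkβ {n : ℕ} (U : Set (Coord n)) (k : ℕ) (β : ℝ) (u : Coord n → ℝ) : Prop :=
  ContDiffOn ℝ k u U ∧ ∃ C : ℝ, ∀ l : ℕ, l ≤ k → ∀ x ∈ U,
    ‖x‖ ^ (β + (l : ℝ)) * ‖iteratedFDeriv ℝ l u x‖ ≤ C

/-! ### Asymptotically Euclidean manifolds -/

/-- A manifold that is the union of a compact set and finitely many ends, together with a
preparation: end charts `Ω_I ≅ {r > r₀}`, charts `W_K ≅` ball covering the compact set, and a
smooth partition of unity `f_I, f_K` adapted to them. -/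
structure Preparation (n : ℕ) (M : Type*) [TopologicalSpace M] [ChartedSpace (Coord n) M] where
  /-- number of ends -/
  N : ℕ
  /-- number of the other domains -/
  N' : ℕ
  r₀ : ℝ
  r₀_pos : 0 < r₀
  /-- coordinates of the ends `Ω_I` -/
  endChart : Fin N → OpenPartialHomeomorph M (Coord n)
  endChart_mem : ∀ I, endChart I ∈ IsManifold.maximalAtlas (𝓡 n) ∞ M
  endChart_target : ∀ I, (endChart I).target = exterior n r₀
  /-- coordinates of the domains `W_K` -/
  ballChart : Fin N' → OpenPartialHomeomorph M (Coord n)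
  ballChart_mem : ∀ K, ballChart K ∈ IsManifold.maximalAtlas (𝓡 n) ∞ M
  center : Fin N' → Coord n
  radius : Fin N' → ℝ
  radius_pos : ∀ K, 0 < radius K
  ballChart_target : ∀ K, (ballChart K).target = Metric.ball (center K) (radius K)
  /-- the compact part -/
  W : Set M
  isCompact_W : IsCompact W
  union_eq : W ∪ ⋃ I, (endChart I).source = Set.univ
  W_subset : W ⊆ ⋃ K, (ballChart K).source
  overlap : ∀ I K, ∀ p ∈ (endChart I).source, p ∈ (ballChart K).source →
    ‖endChart I p‖ ≤ 2 * r₀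
  /-- the functions `f_I` -/
  fEnd : Fin N → M → ℝ
  /-- the functions `f_K` -/
  fBall : Fin N' → M → ℝ
  fEnd_smooth : ∀ I, ContMDiff (𝓡 n) 𝓘(ℝ, ℝ) ∞ (fEnd I)
  fBall_smooth : ∀ K, ContMDiff (𝓡 n) 𝓘(ℝ, ℝ) ∞ (fBall K)
  fEnd_nonneg : ∀ I p, 0 ≤ fEnd I p
  fBall_nonneg : ∀ K p, 0 ≤ fBall K p
  fEnd_supp : ∀ I, tsupport (fEnd I) ⊆ (endChart I).source
  fBall_supp : ∀ K, tsupport (fBall K) ⊆ (ballChart K).source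
  sum_eq_one : ∀ p, (∑ I, fEnd I p) + ∑ K, fBall K p = 1
  fEnd_eq_one : ∀ I, ∀ p ∈ (endChart I).source, 2 * r₀ < ‖endChart I p‖ → fEnd I p = 1

section Manifold

variable {n : ℕ} {M : Type*} [TopologicalSpace M] [ChartedSpace (Coord n) M]
  [IsManifold (𝓡 n) ∞ M]

/-- A continuous Riemannian metric on the manifold `M`. -/
abbrev RMetric (n : ℕ) (M : Type*) [TopologicalSpace M] [ChartedSpace (Coord n) M]
    [IsManifold (𝓡 n) ∞ M] :=
  Bundle.ContinuousRiemannianMetric (Coord n) (fun p : M => TangentSpace (𝓡 n) p)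

/-- The matrix `g_{ij}(x)` of components of the metric in a chart. -/
noncomputable def metricComp (g : RMetric n M) (φ : OpenPartialHomeomorph M (Coord n))
    (x : Coord n) : Matrix (Fin n) (Fin n) ℝ :=
  Matrix.of fun i j => g.inner (φ.symm x)
    (mfderiv (𝓡 n) (𝓡 n) φ.symm x (coordVec i)) (mfderiv (𝓡 n) (𝓡 n) φ.symm x (coordVec j))

/-- The components are bounded above and below on `U` by constant positive definite forms. -/
def UniformlyElliptic (U : Set (Coord n)) (G : Coord n → Matrix (Fin n) (Fin n) ℝ) : Prop :=
  ∃ c C : ℝ, 0 < c ∧ ∀ x ∈ U, ∀ v : Fin n → ℝ,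
    c * (v ⬝ᵥ v) ≤ v ⬝ᵥ (G x *ᵥ v) ∧ v ⬝ᵥ (G x *ᵥ v) ≤ C * (v ⬝ᵥ v)

/-- A function on the end `Ω_I`, given in its coordinates, multiplied by `f_I`. -/
noncomputable def endCutoff (P : Preparation n M) (I : Fin P.N) (u : Coord n → ℝ)
    (x : Coord n) : ℝ :=
  P.fEnd I ((P.endChart I).symm x) * u x

/-- `(M, g)` is asymptotically Euclidean with the indices `s, δ` (with respect to the preparation
`P`): `f_I (g - e) ∈ H_{s,δ} ∩ C¹_{n-2}` and `f_K g ∈ H_s`. -/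
structure IsAsymptoticallyEuclidean (P : Preparation n M) (g : RMetric n M)
    (s : ℕ) (δ : ℝ) : Prop where
  lt_s : (n : ℝ) / 2 + 1 < s
  δ_lt : δ < (n : ℝ) / 2 - 2
  lt_δ : -((n : ℝ) / 2) < δ
  elliptic_end : ∀ I, UniformlyElliptic (exterior n P.r₀) (metricComp g (P.endChart I))
  elliptic_ball : ∀ K, UniformlyElliptic (P.ballChart K).target (metricComp g (P.ballChart K))
  end_mem : ∀ I i j,
    MemHsδ (exterior n P.r₀) s δ (endCutoff P I fun x =>
      metricComp g (P.endChart I) x i j - (1 : Matrix (Fin n) (Fin n) ℝ) i j) ∧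
    MemCkβ (exterior n P.r₀) 1 ((n : ℝ) - 2) (endCutoff P I fun x =>
      metricComp g (P.endChart I) x i j - (1 : Matrix (Fin n) (Fin n) ℝ) i j)
  ball_mem : ∀ K i j, MemHs (P.ballChart K).target s (fun x =>
    P.fBall K ((P.ballChart K).symm x) * metricComp g (P.ballChart K) x i j)

/-- `A` is an asymptotically Euclidean orthonormal coframe of `g` in the end `Ω_I`: with
`A x i j = a_i^j(x)` and `θʲ = a_i^j dxⁱ`, one has `g_{ij} = ∑ₕ a_i^h a_j^h` and
`a_i^j = δ_i^j + λ_i^j / 2` with `λ_i^j ∈ H_{s,δ} ∩ C¹_{n-2}`. -/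
structure IsAECoframe (P : Preparation n M) (g : RMetric n M) (s : ℕ) (δ : ℝ) (I : Fin P.N)
    (A : Coord n → Matrix (Fin n) (Fin n) ℝ) : Prop where
  orthonormal : ∀ x ∈ exterior n P.r₀, metricComp g (P.endChart I) x = A x * (A x)ᵀ
  asymptotics : ∀ i j,
    MemHsδ (exterior n P.r₀) s δ (endCutoff P I fun x =>
      2 * (A x i j - (1 : Matrix (Fin n) (Fin n) ℝ) i j)) ∧
    MemCkβ (exterior n P.r₀) 1 ((n : ℝ) - 2) (endCutoff P I fun x =>
      2 * (A x i j - (1 : Matrix (Fin n) (Fin n) ℝ) i j))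

end Manifold

/-! ### Spheres, mass -/

section Coordinates

variable {n : ℕ}

/-- The integral of `F` over the sphere `S_r = {‖x‖ = r}` for its Euclidean area element. -/
noncomputable def sphereIntegral (r : ℝ) (F : Coord n → ℝ) : ℝ :=
  r ^ (n - 1) * ∫ z : Metric.sphere (0 : Coord n) 1, F (r • (z : Coord n))
    ∂((volume : Measure (Coord n)).toSphere)

/-- The coordinate components `∂r/∂xⁱ = xⁱ/r` of the covector `dr`. -/
noncomputable def drCovec (x : Coord n) (i : Fin n) : ℝ := x i / ‖x‖

/-- The norm `|dr|_g` of `dr` for the metric with components `G`. -/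
noncomputable def drNorm (G : Coord n → Matrix (Fin n) (Fin n) ℝ) (x : Coord n) : ℝ :=
  Real.sqrt (drCovec x ⬝ᵥ ((G x)⁻¹ *ᵥ drCovec x))

/-- The coordinate components of the `g`-unit conormal `dr / |dr|_g` of the sphere `S_r`. -/
noncomputable def unitConormal (G : Coord n → Matrix (Fin n) (Fin n) ℝ) (x : Coord n)
    (i : Fin n) : ℝ :=
  drCovec x i / drNorm G x

/-- Density, with respect to the Euclidean area element, of the area element `μ_ḡ` that `g` induces
on `S_r`. It is the interior product of the unit normal with the volume form of `g`,
`√(det g) dr ∧ μ_e`, and `dr` takes the value `|dr|_g` on the unit normal. -/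
noncomputable def areaDensity (G : Coord n → Matrix (Fin n) (Fin n) ℝ) (x : Coord n) : ℝ :=
  Real.sqrt (G x).det * drNorm G x

/-- `(1/2) ∫_{S_r} (∂_j g_{ij} - ∂_i g_{jj}) n_i μ_ḡ`, in the coordinates of an end. -/
noncomputable def massIntegral (G : Coord n → Matrix (Fin n) (Fin n) ℝ) (r : ℝ) : ℝ :=
  1 / 2 * sphereIntegral r fun x =>
    (∑ i, ∑ j, (pderiv j (fun y => G y i j) x - pderiv i (fun y => G y j j) x)
      * unitConormal G x i) * areaDensity G x

/-- `m` is the gravitational (ADM) mass of the end in which the metric has components `G`. -/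
def IsMass (G : Coord n → Matrix (Fin n) (Fin n) ℝ) (m : ℝ) : Prop :=
  Tendsto (massIntegral G) atTop (𝓝 m)

/-! ### The spin connection -/

/-- The dual frame of the coframe `θʲ = a_i^j dxⁱ`: `frame A x j k = b_j^k`, `e_j = b_j^k ∂_k`. -/
noncomputable def frame (A : Coord n → Matrix (Fin n) (Fin n) ℝ) (x : Coord n) :
    Matrix (Fin n) (Fin n) ℝ :=
  (A x)⁻¹

/-- Rotation coefficients `c^h_{ij} = dθ^h(e_i, e_j)`, i.e. `dθ^h = (1/2) c^h_{ij} θⁱ ∧ θʲ`. -/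
noncomputable def rotCoeff (A : Coord n → Matrix (Fin n) (Fin n) ℝ) (h i j : Fin n)
    (x : Coord n) : ℝ :=
  ∑ k, ∑ l, frame A x i k * frame A x j l *
    (pderiv k (fun y => A y l h) x - pderiv l (fun y => A y k h) x)

/-- Components `ω_{i,jh} = g(e_j, ∇_{e_i} e_h)` of the Riemannian (Levi-Civita) connection in the
orthonormal coframe. -/
noncomputable def connCoeff (A : Coord n → Matrix (Fin n) (Fin n) ℝ) (i j h : Fin n)
    (x : Coord n) : ℝ :=
  1 / 2 * (-rotCoeff A i j h x + rotCoeff A h i j x - rotCoeff A j i h x)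

/-- `2^{[n/2]} × 2^{[n/2]}` complex matrices, acting on the space `S` of spinors. -/
abbrev SpinMatrix (n : ℕ) : Type := Matrix (Fin (2 ^ (n / 2))) (Fin (2 ^ (n / 2))) ℂ

/-- Representatives of spinors: elements of the space `S` of dimension `2^{[n/2]}`. -/
abbrev SpinVec (n : ℕ) : Type := Fin (2 ^ (n / 2)) → ℂ

/-- Hermitian gamma matrices: `γ_i γ_j + γ_j γ_i = 2 η_{ij}`. -/
structure IsGamma (γ : Fin n → SpinMatrix n) : Prop where
  clifford : ∀ i j, γ i * γ j + γ j * γ i = (2 * (1 : Matrix (Fin n) (Fin n) ℂ) i j) • 1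
  hermitian : ∀ i, (γ i).IsHermitian

/-- The spin connection `σ_i = (1/4) γ^h γ^k ω_{i,hk}` of the coframe. -/
noncomputable def spinConn (γ : Fin n → SpinMatrix n)
    (A : Coord n → Matrix (Fin n) (Fin n) ℝ) (i : Fin n) (x : Coord n) : SpinMatrix n :=
  (1 / 4 : ℂ) • ∑ h, ∑ k, (connCoeff A i h k x : ℂ) • (γ h * γ k)

/-- The vector `𝒰ⁱ = Re (ψ̃ (η^{ij} - γⁱ γʲ) σ_j ψ)`, frame components, of a spinor represented by
`ψ` in the given frame; `ψ̃` is the complex conjugate transpose of `ψ`. -/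
noncomputable def spinVector (γ : Fin n → SpinMatrix n)
    (A : Coord n → Matrix (Fin n) (Fin n) ℝ) (ψ : Coord n → SpinVec n) (i : Fin n)
    (x : Coord n) : ℝ :=
  (star (ψ x) ⬝ᵥ ((∑ j, ((1 : Matrix (Fin n) (Fin n) ℂ) i j • (1 : SpinMatrix n) - γ i * γ j)
    * spinConn γ A j x) *ᵥ ψ x)).re

/-- `∫_{S_r} 𝒰ⁱ n_i μ_ḡ`; the frame components of the unit conormal are `n_i = b_i^k n_k`. -/
noncomputable def spinIntegral (γ : Fin n → SpinMatrix n)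
    (G A : Coord n → Matrix (Fin n) (Fin n) ℝ) (ψ : Coord n → SpinVec n) (r : ℝ) : ℝ :=
  sphereIntegral r fun x =>
    (∑ i, spinVector γ A ψ i x * (frame A x *ᵥ unitConormal G x) i) * areaDensity G x

/-! ### Scalar curvature and the Hamiltonian constraint -/

/-- Christoffel symbols `Γᵉ_{bc}`. -/
noncomputable def christoffel (G : Coord n → Matrix (Fin n) (Fin n) ℝ) (e b c : Fin n)
    (x : Coord n) : ℝ :=
  1 / 2 * ∑ m, (G x)⁻¹ e m * (pderiv b (fun y => G y m c) x + pderiv c (fun y => G y m b) x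
    - pderiv m (fun y => G y b c) x)

/-- The curvature components `R_{abcd}` of the metric `G`, with `D2 a b c d` standing for the (weak)
second derivative `∂_a ∂_b g_{cd}`; the sign is such that `g^{ac} g^{bd} R_{abcd}` is positive for
round spheres. -/
noncomputable def riemannComp (G : Coord n → Matrix (Fin n) (Fin n) ℝ)
    (D2 : Fin n → Fin n → Fin n → Fin n → Coord n → ℝ) (a b c d : Fin n) (x : Coord n) : ℝ :=
  1 / 2 * (D2 b c a d x + D2 a d b c x - D2 a c b d x - D2 b d a c x)
    + ∑ e, ∑ f, G x e f * (christoffel G e b c x * christoffel G f a d x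
      - christoffel G e b d x * christoffel G f a c x)

/-- The scalar curvature `R = g^{ac} g^{bd} R_{abcd}`. -/
noncomputable def scalarCurv (G : Coord n → Matrix (Fin n) (Fin n) ℝ)
    (D2 : Fin n → Fin n → Fin n → Fin n → Coord n → ℝ) (x : Coord n) : ℝ :=
  ∑ a, ∑ b, ∑ c, ∑ d, (G x)⁻¹ a c * (G x)⁻¹ b d * riemannComp G D2 a b c d x

/-- The Hamiltonian constraint `R - |K|² + (tr K)² = 2 T₀₀` almost everywhere on `U`, with a
nonnegative energy density `T₀₀`, the scalar curvature being computed with weak second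
derivatives. -/
def HamiltonianConstraint (U : Set (Coord n)) (G K : Coord n → Matrix (Fin n) (Fin n) ℝ) : Prop :=
  ∃ (D2 : Fin n → Fin n → Fin n → Fin n → Coord n → ℝ) (T00 : Coord n → ℝ),
    (∀ a b c d, IsWeakDeriv U ![a, b] (fun y => G y c d) (D2 a b c d)) ∧
    ∀ᵐ x ∂((volume : Measure (Coord n)).restrict U), 0 ≤ T00 x ∧
      scalarCurv G D2 x - ((G x)⁻¹ * K x * (G x)⁻¹ * (K x)ᵀ).trace
        + ((G x)⁻¹ * K x).trace ^ 2 = 2 * T00 x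

end Coordinates

/-!
The theorem compares two flux integrals over large coordinate spheres and then shows that one of
them converges.

**Comparison.** The coefficients `g_{ij}`, `a_i^j`, their inverses and `√(det g)` are constant up to
`O(r^{2-n})` and have derivatives `O(r^{1-n})` (`IsAsympConst`, a class closed under products and
composition with `C¹` functions). The area of `S_r` grows like `r^{n-1}`, so in a flux density,
which is linear in first derivatives, every coefficient may be replaced by its limit, and the normal
and area element by the Euclidean ones (`FluxEquiv`); this is where `n > 2` enters. At this linear
level put `τ_{ijhk}` for the totally antisymmetric part of `Re ψ̃ γ_i γ_j γ_h γ_k ψ` (`quadExpect`).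
The bivectors `γ_h γ_k` are antihermitian, so by the Clifford relations only the scalar part and the
four-vector part of `γ_i γ_j γ_h γ_k` contribute to `𝒰`. The scalar part gives the trace of the
connection, which is half of the mass density up to `∂ⱼ(a_{ij} - a_{ji})/4`, and the four-vector
part gives `-τ_{ijhk} ∂ⱼ a_{hk} / 4` (`sum_quadExpect_mul_linConn`). Both discrepancies are
divergences of antisymmetric matrices and have zero flux, because `xⁱ∂ⱼ - xʲ∂ᵢ` generates rotations
of the sphere (`sphereIntegral_curl_eq_zero`). For functions that are only `C¹` this is proved by
testing with radial functions, integrating by parts and using polar coordinates.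

**Existence.** `√g R` is, weakly, the divergence of a vector field whose flux is asymptotic to twice
the mass integral, plus terms quadratic in `∂g`, which are `O(r^{2-2n})` and hence integrable
(`hasRadialDiv_scalarCurv`). Here the weak second derivatives have to be tested with functions that
are only `C¹`, which needs a mollification (`IsWeakDeriv.integral_mul_eq_neg_integral_pderiv`). By
the constraint with `T₀₀ ≥ 0` the divergence is bounded below by `-C r^{2-2n}`, so that the flux is
monotone up to a term that tends to zero. Since it is bounded, it converges
(`HasRadialDiv.exists_tendsto_sphereIntegral`). The second derivatives themselves are never
estimated.
-/

/-! ### Test functions and weak derivatives -/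

section TestFunctions

theorem MeasureTheory.LocallyIntegrableOn.integrable_mul_of_tsupport_subset {E : Type*}
    [MetricSpace E] [MeasurableSpace E] [OpensMeasurableSpace E] {μ : Measure E}
    {U : Set E} {v φ : E → ℝ} (hv : LocallyIntegrableOn v U μ) (hφ : Continuous φ)
    (hc : HasCompactSupport φ) (hs : tsupport φ ⊆ U) : Integrable (fun x => v x * φ x) μ := by
  have h1 : IntegrableOn (fun x => v x * φ x) (tsupport φ) μ :=
    (hv.integrableOn_compact_subset hs hc).mul_continuousOn hφ.continuousOn hc
  refine (integrableOn_iff_integrable_of_support_subset ?_).1 h1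
  intro x hx
  exact subset_tsupport φ fun h => hx (by simp [h])

theorem ContinuousOn.integrable_mul_of_tsupport_subset {E : Type*}
    [MetricSpace E] [MeasurableSpace E] [OpensMeasurableSpace E]
    [SecondCountableTopology E] {μ : Measure E} [IsLocallyFiniteMeasure μ]
    {U : Set E} {v φ : E → ℝ} (hv : ContinuousOn v U) (hU : MeasurableSet U) (hφ : Continuous φ)
    (hc : HasCompactSupport φ) (hs : tsupport φ ⊆ U) : Integrable (fun x => v x * φ x) μ :=
  (hv.locallyIntegrableOn hU).integrable_mul_of_tsupport_subset hφ hc hs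

variable {E : Type*} [NormedAddCommGroup E] [NormedSpace ℝ E]

theorem tsupport_fderiv_apply_subset_tsupport (φ : E → ℝ) (v : E) :
    tsupport (fun x => fderiv ℝ φ x v) ⊆ tsupport φ := by
  refine (closure_mono fun x hx => ?_).trans (tsupport_fderiv_subset ℝ)
  exact fun h => hx (by simp [h])

theorem HasCompactSupport.fderiv_apply_of_real {φ : E → ℝ} (h : HasCompactSupport φ) (v : E) :
    HasCompactSupport (fun x => fderiv ℝ φ x v) :=
  h.of_isClosed_subset (isClosed_tsupport _) (tsupport_fderiv_apply_subset_tsupport φ v)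

variable [FiniteDimensional ℝ E] [MeasurableSpace E] [BorelSpace E] {μ : Measure E}

/-- Integration by parts on an open set against a compactly supported `C¹` test function. -/
theorem integral_mul_fderiv_eq_neg_of_tsupport_subset [μ.IsAddHaarMeasure] {U : Set E}
    (hU : IsOpen U) {u φ : E → ℝ} (hu : ContDiffOn ℝ 1 u U) (hφ : ContDiff ℝ 1 φ) (hc : HasCompactSupport φ)
    (hs : tsupport φ ⊆ U) (v : E) :
    ∫ x, u x * fderiv ℝ φ x v ∂μ = -∫ x, fderiv ℝ u x v * φ x ∂μ := by
  have hφ' : Continuous fun x => fderiv ℝ φ x v :=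
    (hφ.continuous_fderiv one_ne_zero).clm_apply continuous_const
  have hu' : ContinuousOn (fun x => fderiv ℝ u x v) U :=
    (hu.continuousOn_fderiv_of_isOpen hU le_rfl).clm_apply continuousOn_const
  have hsub := tsupport_fderiv_apply_subset_tsupport φ v
  refine integral_mul_fderiv_eq_neg_fderiv_mul_of_integrable ?_ ?_ ?_ ?_ ?_
  · exact hu'.integrable_mul_of_tsupport_subset hU.measurableSet hφ.continuous hc hs
  · exact hu.continuousOn.integrable_mul_of_tsupport_subset hU.measurableSet hφ'
      (hc.fderiv_apply_of_real v) (hsub.trans hs)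
  · exact hu.continuousOn.integrable_mul_of_tsupport_subset hU.measurableSet hφ.continuous hc hs
  · exact fun x hx => (hu.contDiffAt (hU.mem_nhds (hs hx))).differentiableAt one_ne_zero
  · exact fun x _ => hφ.differentiable one_ne_zero x

/-- A compactly supported `C¹` function is the limit of smooth functions with supports in a common
compact set; the functions and their derivatives in a given direction converge boundedly. -/
theorem exists_contDiff_approx {U : Set E} (hU : IsOpen U) {φ : E → ℝ} (hφ : ContDiff ℝ 1 φ)
    (hc : HasCompactSupport φ) (hs : tsupport φ ⊆ U) :
    ∃ (Φ : ℕ → E → ℝ) (K : Set E), IsCompact K ∧ K ⊆ U ∧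
      (∀ k, ContDiff ℝ ∞ (Φ k)) ∧ (∀ k, tsupport (Φ k) ⊆ K) ∧
      (∀ x, Tendsto (fun k => Φ k x) atTop (𝓝 (φ x))) ∧
      (∃ C, ∀ k x, ‖Φ k x‖ ≤ C) ∧
      ∀ v, (∀ x, Tendsto (fun k => fderiv ℝ (Φ k) x v) atTop (𝓝 (fderiv ℝ φ x v))) ∧
        ∃ C, ∀ k x, ‖fderiv ℝ (Φ k) x v‖ ≤ C := by
  obtain ⟨μ, hμ⟩ : ∃ μ : Measure E, μ.IsAddHaarMeasure := ⟨Measure.addHaar, inferInstance⟩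
  obtain ⟨ε, hε, hεU⟩ := IsCompact.exists_cthickening_subset_open hc hU hs
  let ρ : ℕ → ContDiffBump (0 : E) := fun k =>
    { rIn := ε / (k + 2) / 2, rOut := ε / (k + 2)
      rIn_pos := by positivity
      rIn_lt_rOut := half_lt_self (by positivity) }
  have hρle : ∀ k, (ρ k).rOut ≤ ε := fun k => by
    change ε / ((k : ℝ) + 2) ≤ ε
    exact div_le_self hε.le (by linarith [(Nat.cast_nonneg k : (0:ℝ) ≤ k)])
  have hρ0 : Tendsto (fun k => (ρ k).rOut) atTop (𝓝 0) := by
    change Tendsto (fun k : ℕ => ε / ((k : ℝ) + 2)) atTop (𝓝 0)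
    exact tendsto_const_nhds.div_atTop
      (tendsto_atTop_add_const_right _ _ tendsto_natCast_atTop_atTop)
  let conv : ℕ → (E → ℝ) → E → ℝ := fun k f =>
    MeasureTheory.convolution ((ρ k).normed μ) f (ContinuousLinearMap.lsmul ℝ ℝ) μ
  have hli : ∀ k, LocallyIntegrable ((ρ k).normed μ) μ := fun k =>
    (ρ k).integrable_normed.locallyIntegrable
  have hbdd : ∀ f : E → ℝ, Continuous f → HasCompactSupport f → ∃ C, ∀ k x, ‖conv k f x‖ ≤ C := by
    intro f hf hfc
    obtain ⟨C, hC⟩ := hfc.exists_bound_of_continuous hf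
    refine ⟨C, fun k x => ?_⟩
    have := dist_convolution_le (f := (ρ k).normed μ) (g := f) (x₀ := x) (z₀ := (0 : ℝ)) (μ := μ)
      ((norm_nonneg _).trans (hC x)) (ρ k).support_normed_eq.subset (ρ k).nonneg_normed
      (ρ k).integral_normed hf.aestronglyMeasurable
      (fun y _ => by simpa using hC y)
    simpa using this
  have hder : ∀ k x v, fderiv ℝ (conv k φ) x v = conv k (fun y => fderiv ℝ φ y v) x := by
    intro k x v
    rw [(hc.hasFDerivAt_convolution_right (ContinuousLinearMap.lsmul ℝ ℝ) (hli k) hφ x).fderiv]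
    exact convolution_precompR_apply _ (hli k) (hc.fderiv ℝ)
      (hφ.continuous_fderiv one_ne_zero) x v
  have hcont : ∀ v, Continuous fun x => fderiv ℝ φ x v := fun v =>
    (hφ.continuous_fderiv one_ne_zero).clm_apply continuous_const
  refine ⟨fun k => conv k φ, Metric.cthickening ε (tsupport φ), hc.cthickening, hεU, ?_, ?_, ?_,
    hbdd φ hφ.continuous hc, ?_⟩
  · intro k
    exact (ρ k).hasCompactSupport_normed.contDiff_convolution_left _ (ρ k).contDiff_normed
      hφ.continuous.locallyIntegrable
  · intro k
    refine closure_minimal ?_ Metric.isClosed_cthickening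
    refine (support_convolution_subset _).trans ?_
    rintro _ ⟨y, hy, z, hz, rfl⟩
    rw [(ρ k).support_normed_eq] at hy
    refine Metric.mem_cthickening_of_dist_le _ z ε _ (subset_tsupport _ hz) ?_
    have hy' : ‖y‖ < (ρ k).rOut := by simpa using hy
    simpa [dist_eq_norm] using (hy'.le.trans (hρle k))
  · exact fun x => ContDiffBump.convolution_tendsto_right_of_continuous hρ0 hφ.continuous x
  · intro v
    simp only [hder]
    exact ⟨fun x => ContDiffBump.convolution_tendsto_right_of_continuous hρ0 (hcont v) x,
      hbdd _ (hcont v) (hc.fderiv_apply_of_real v)⟩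

/-- If a locally integrable function `v` is the weak derivative of `w` in the direction `e` when
tested with smooth functions, then also when tested with `C¹` functions. -/
theorem integral_mul_eq_neg_of_forall_contDiff {U : Set E} (hU : IsOpen U) {v w : E → ℝ} {e : E}
    (hv : LocallyIntegrableOn v U μ) (hw : LocallyIntegrableOn w U μ)
    (h : ∀ φ : E → ℝ, ContDiff ℝ ∞ φ → HasCompactSupport φ → tsupport φ ⊆ U →
      ∫ x, v x * φ x ∂μ = -∫ x, w x * fderiv ℝ φ x e ∂μ)
    {φ : E → ℝ} (hφ : ContDiff ℝ 1 φ) (hc : HasCompactSupport φ) (hs : tsupport φ ⊆ U) :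
    ∫ x, v x * φ x ∂μ = -∫ x, w x * fderiv ℝ φ x e ∂μ := by
  obtain ⟨Φ, K, hK, hKU, hΦ, hΦK, hlim, ⟨C, hC⟩, hder⟩ :=
    exists_contDiff_approx hU hφ hc hs
  obtain ⟨hlim', C', hC'⟩ := hder e
  have key : ∀ (u : E → ℝ) (ψ : ℕ → E → ℝ) (ψ₀ : E → ℝ) (C : ℝ), LocallyIntegrableOn u U μ →
      (∀ k, Continuous (ψ k)) → (∀ k, tsupport (ψ k) ⊆ K) → (∀ k x, ‖ψ k x‖ ≤ C) →
      (∀ x, Tendsto (fun k => ψ k x) atTop (𝓝 (ψ₀ x))) →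
      Tendsto (fun k => ∫ x, u x * ψ k x ∂μ) atTop (𝓝 (∫ x, u x * ψ₀ x ∂μ)) := by
    intro u ψ ψ₀ C hu hψ hψK hψC hψlim
    have huK : IntegrableOn u K μ := hu.integrableOn_compact_subset hKU hK
    refine tendsto_integral_of_dominated_convergence (K.indicator fun x => ‖u x‖ * C) ?_ ?_ ?_ ?_
    · intro k
      exact (hu.integrable_mul_of_tsupport_subset (hψ k)
        (hK.of_isClosed_subset (isClosed_tsupport _) (hψK k))
        ((hψK k).trans hKU)).aestronglyMeasurable
    · exact (integrable_indicator_iff hK.measurableSet).2 (huK.norm.mul_const C)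
    · refine fun k => Eventually.of_forall fun x => ?_
      by_cases hx : x ∈ K
      · rw [Set.indicator_of_mem hx, norm_mul]
        exact mul_le_mul_of_nonneg_left (hψC k x) (norm_nonneg _)
      · rw [Set.indicator_of_notMem hx, image_eq_zero_of_notMem_tsupport fun h' => hx (hψK k h')]
        simp
    · exact Eventually.of_forall fun x => (hψlim x).const_mul _
  have h1 := key v Φ φ C hv (fun k => (hΦ k).continuous) hΦK hC hlim
  have h2 := key w (fun k x => fderiv ℝ (Φ k) x e) (fun x => fderiv ℝ φ x e) C' hw
    (fun k => ((hΦ k).continuous_fderiv (by simp)).clm_apply continuous_const)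
    (fun k => (tsupport_fderiv_apply_subset_tsupport _ _).trans (hΦK k)) hC' hlim'
  refine tendsto_nhds_unique h1 (h2.neg.congr fun k => ?_)
  exact (h (Φ k) (hΦ k) (hK.of_isClosed_subset (isClosed_tsupport _) (hΦK k))
    ((hΦK k).trans hKU)).symm

end TestFunctions

section WeakDerivatives

variable {n : ℕ}

/-- A weak second derivative of a `C¹` function `u` is a weak derivative of `∂_b u`, and may be
tested with functions that are only `C¹`. -/
theorem IsWeakDeriv.integral_mul_eq_neg_integral_pderiv {U V : Set (Coord n)} (hV : IsOpen V)
    (hVU : V ⊆ U) {a b : Fin n} {u v : Coord n → ℝ} (h : IsWeakDeriv U ![a, b] u v)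
    (hu : ContDiffOn ℝ 1 u V) {φ : Coord n → ℝ} (hφ : ContDiff ℝ 1 φ) (hc : HasCompactSupport φ)
    (hs : tsupport φ ⊆ V) :
    ∫ x, v x * φ x = -∫ x, pderiv a u x * pderiv b φ x := by
  obtain ⟨-, hv, hweak⟩ := h
  have hu' : ContinuousOn (pderiv a u) V :=
    (hu.continuousOn_fderiv_of_isOpen hV le_rfl).clm_apply continuousOn_const
  refine integral_mul_eq_neg_of_forall_contDiff hV (hv.mono_set hVU)
    (hu'.locallyIntegrableOn hV.measurableSet) ?_ hφ hc hs
  intro ψ hψ hψc hψs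
  have h0 : ∫ x in U, u x * iteratedFDeriv ℝ 2 ψ x (fun i => coordVec (![a, b] i)) =
      (-1) ^ 2 * ∫ x in U, v x * ψ x := hweak ψ hψ hψc (hψs.trans hVU)
  rw [neg_one_sq, one_mul] at h0
  have hψ1 : ContDiff ℝ 1 (fun x => fderiv ℝ ψ x (coordVec b)) :=
    (hψ.fderiv_right (m := 1) (by norm_cast)).clm_apply contDiff_const
  have hsub := tsupport_fderiv_apply_subset_tsupport ψ (coordVec b)
  rw [setIntegral_eq_integral_of_forall_compl_eq_zero (fun x hx => ?_),
    setIntegral_eq_integral_of_forall_compl_eq_zero (fun x hx => ?_)] at h0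
  · rw [← h0]
    have h1 : ∀ x, iteratedFDeriv ℝ 2 ψ x (fun i => coordVec (![a, b] i)) =
        fderiv ℝ (fun y => fderiv ℝ ψ y (coordVec b)) x (coordVec a) := by
      intro x
      rw [iteratedFDeriv_two_apply]
      have hd : DifferentiableAt ℝ (fderiv ℝ ψ) x :=
        (hψ.fderiv_right (m := 1) (by norm_cast)).differentiable one_ne_zero x
      rw [fderiv_clm_apply hd (differentiableAt_const _)]
      simp
    simp only [h1]
    exact integral_mul_fderiv_eq_neg_of_tsupport_subset hV hu hψ1
      (hψc.fderiv_apply_of_real _) (hsub.trans hψs) _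
  · rw [image_eq_zero_of_notMem_tsupport fun h' => hx (hVU (hψs h'))]; simp
  · have : x ∉ tsupport (iteratedFDeriv ℝ 2 ψ) := fun h' =>
      hx (hVU (hψs (tsupport_iteratedFDeriv_subset (𝕜 := ℝ) 2 h')))
    rw [image_eq_zero_of_notMem_tsupport this]; simp

end WeakDerivatives

/-! ### Functions of one variable tested against compactly supported functions -/

section OneVariable

/-- A continuous function whose distributional derivative is nonnegative is monotone. -/
theorem monotoneOn_Ioi_of_integral_deriv_mul_nonpos {R : ℝ} {F : ℝ → ℝ}
    (hF : ContinuousOn F (Set.Ioi R))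
    (h : ∀ χ : ℝ → ℝ, ContDiff ℝ 1 χ → HasCompactSupport χ → tsupport χ ⊆ Set.Ioi R →
      (∀ t, 0 ≤ χ t) → ∫ t, deriv χ t * F t ≤ 0) :
    MonotoneOn F (Set.Ioi R) := by
  intro a ha b hb hab
  have ha' : R < a := ha
  let ε : ℝ := (a - R) / 2
  have hε : 0 < ε := by simp only [ε]; linarith
  let ρ : ℕ → ContDiffBump (0 : ℝ) := fun k =>
    { rIn := ε / (k + 2) / 2, rOut := ε / (k + 2)
      rIn_pos := by positivity
      rIn_lt_rOut := half_lt_self (by positivity) }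
  have hρle : ∀ k, (ρ k).rOut ≤ ε := fun k => by
    change ε / ((k : ℝ) + 2) ≤ ε
    exact div_le_self hε.le (by linarith [(Nat.cast_nonneg k : (0:ℝ) ≤ k)])
  have hρ0 : Tendsto (fun k => (ρ k).rOut) atTop (𝓝 0) := by
    change Tendsto (fun k : ℕ => ε / ((k : ℝ) + 2)) atTop (𝓝 0)
    exact tendsto_const_nhds.div_atTop
      (tendsto_atTop_add_const_right _ _ tendsto_natCast_atTop_atTop)
  -- `F` is cut off because nothing is known about it, not even measurability, outside `Ioi R`
  let G : ℝ → ℝ := (Set.Ioi R).indicator F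
  have hGm : AEStronglyMeasurable G volume :=
    (aestronglyMeasurable_indicator_iff measurableSet_Ioi).2
      (hF.aestronglyMeasurable measurableSet_Ioi)
  let r : ℕ → ℝ → ℝ := fun k => (ρ k).normed volume
  have hr0 : ∀ k t, ε < |t| → r k t = 0 := fun k t ht => by
    have : t ∉ Function.support ((ρ k).normed volume) := by
      rw [(ρ k).support_normed_eq]
      simpa using (hρle k).trans ht.le
    simpa using this
  have hrc : ∀ k, Continuous (r k) := fun k => (ρ k).continuous_normed
  have hlim : ∀ c ∈ Set.Ioi R, Tendsto (fun k => ∫ t, r k (t - c) * G t) atTop (𝓝 (F c)) := by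
    intro c hc
    have hGc : Tendsto G (𝓝 c) (𝓝 (F c)) := by
      refine (hF.continuousAt (Ioi_mem_nhds hc)).tendsto.congr' ?_
      filter_upwards [Ioi_mem_nhds hc] with t ht
      exact (Set.indicator_of_mem ht F).symm
    have := ContDiffBump.convolution_tendsto_right (μ := volume) (φ := ρ) (g := fun _ => G)
      (k := fun _ => c) (x₀ := c) (z₀ := F c) hρ0 (Eventually.of_forall fun _ => hGm)
      (hGc.comp tendsto_snd) tendsto_const_nhds
    refine this.congr fun k => ?_
    rw [convolution_eq_swap]
    refine integral_congr_ae (Eventually.of_forall fun t => ?_)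
    change (ρ k).normed volume (c - t) * G t = (ρ k).normed volume (t - c) * G t
    rw [← (ρ k).normed_neg, neg_sub]
  have hsupp : ∀ k, ∀ c, a ≤ c → tsupport (fun t => r k (t - c)) ⊆ Set.Icc (c - ε) (c + ε) := by
    intro k c _
    refine closure_minimal (fun t ht => ?_) isClosed_Icc
    by_contra hcon
    refine ht (hr0 k _ ?_)
    by_contra hle
    have := abs_le.1 (not_lt.1 hle)
    exact hcon ⟨by linarith [this.1], by linarith [this.2]⟩
  have hIcc : ∀ c d, a ≤ c → Set.Icc (c - ε) d ⊆ Set.Ioi R := by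
    intro c d hc t ht
    have := ht.1
    simp only [Set.mem_Ioi, ε] at *
    linarith
  have hint : ∀ k, ∀ c, a ≤ c → Integrable (fun t => r k (t - c) * F t) := by
    intro k c hc
    have := hF.integrable_mul_of_tsupport_subset (μ := volume) (φ := fun t => r k (t - c))
      measurableSet_Ioi ((hrc k).comp (continuous_id.sub continuous_const))
      (isCompact_Icc.of_isClosed_subset (isClosed_tsupport _) (hsupp k c hc))
      ((hsupp k c hc).trans (hIcc c _ hc))
    simpa only [mul_comm] using this
  have hGF : ∀ k, ∀ c, a ≤ c → ∫ t, r k (t - c) * G t = ∫ t, r k (t - c) * F t := by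
    intro k c hc
    refine integral_congr_ae (Eventually.of_forall fun t => ?_)
    by_cases ht : t ∈ Set.Ioi R
    · simp only [G, Set.indicator_of_mem ht]
    · have : r k (t - c) = 0 := by
        by_contra h0
        exact ht (hIcc c _ hc (hsupp k c hc (subset_tsupport _ h0)))
      simp only [this, zero_mul]
  refine le_of_tendsto_of_tendsto' (hlim a ha) (hlim b hb) fun k => ?_
  rw [hGF k a le_rfl, hGF k b hab]
  -- `χ` is a mollified indicator function of `[a, b]`, so that `∫ χ' F` tends to `F a - F b`
  let χ : ℝ → ℝ := fun t => ∫ s in (t - b)..(t - a), r k s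
  have hχd : ∀ t, HasDerivAt χ (r k (t - a) - r k (t - b)) t := by
    intro t
    have hP : ∀ t, HasDerivAt (fun u => ∫ s in (0:ℝ)..u, r k s) (r k t) t := fun t =>
      (hrc k).integral_hasStrictDerivAt 0 t |>.hasDerivAt
    have hsplit : χ = fun t => (∫ s in (0:ℝ)..(t - a), r k s) - ∫ s in (0:ℝ)..(t - b), r k s := by
      funext t
      exact (intervalIntegral.integral_interval_sub_left ((hrc k).intervalIntegrable _ _)
        ((hrc k).intervalIntegrable _ _)).symm
    rw [hsplit]
    exact ((hP (t - a)).comp_sub_const t a).sub ((hP (t - b)).comp_sub_const t b)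
  have hderiv : deriv χ = fun t => r k (t - a) - r k (t - b) := funext fun t => (hχd t).deriv
  have hχ1 : ContDiff ℝ 1 χ := by
    refine contDiff_one_iff_deriv.2 ⟨fun t => (hχd t).differentiableAt, ?_⟩
    rw [hderiv]
    exact ((hrc k).comp (continuous_id.sub continuous_const)).sub
      ((hrc k).comp (continuous_id.sub continuous_const))
  have hχs : tsupport χ ⊆ Set.Icc (a - ε) (b + ε) := by
    refine closure_minimal (fun t ht => ?_) isClosed_Icc
    by_contra hcon
    refine ht ?_
    refine intervalIntegral.integral_zero_ae (Eventually.of_forall fun s hs => hr0 k s ?_)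
    rw [Set.uIoc_of_le (by linarith)] at hs
    simp only [Set.mem_Icc, not_and_or, not_le] at hcon
    rcases hcon with h1 | h1
    · rw [lt_abs]; right; linarith [hs.2]
    · rw [lt_abs]; left; linarith [hs.1]
  have := h χ hχ1 (isCompact_Icc.of_isClosed_subset (isClosed_tsupport _) hχs)
    (hχs.trans (hIcc a _ le_rfl))
    (fun t => intervalIntegral.integral_nonneg (by linarith) fun s _ => (ρ k).nonneg_normed s)
  rw [hderiv] at this
  simp only [sub_mul] at this
  rw [integral_sub (hint k a le_rfl) (hint k b hab)] at this
  linarith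

/-- A continuous function on a half-line that vanishes as a distribution vanishes. -/
theorem eq_zero_on_Ioi_of_integral_mul_eq_zero {R : ℝ} {F : ℝ → ℝ}
    (hF : ContinuousOn F (Set.Ioi R))
    (h : ∀ χ : ℝ → ℝ, ContDiff ℝ ∞ χ → HasCompactSupport χ → tsupport χ ⊆ Set.Ioi R →
      ∫ t, χ t * F t = 0) {t : ℝ} (ht : R < t) : F t = 0 := by
  have h1 := isOpen_Ioi.ae_eq_zero_of_integral_contDiff_smul_eq_zero
    (hF.locallyIntegrableOn (μ := volume) measurableSet_Ioi) h
  have h2 : F =ᵐ[volume.restrict (Set.Ioi R)] fun _ => 0 :=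
    (ae_restrict_iff' measurableSet_Ioi).2 h1
  exact Measure.eqOn_open_of_ae_eq h2 isOpen_Ioi hF continuousOn_const ht

end OneVariable

/-! ### Spheres and radial functions -/

section Spheres

variable {n : ℕ}

theorem isOpen_exterior (n : ℕ) (R : ℝ) : IsOpen (exterior n R) :=
  isOpen_lt continuous_const continuous_norm

theorem exterior_subset {R R' : ℝ} (h : R ≤ R') : exterior n R' ⊆ exterior n R :=
  fun _ hx => lt_of_le_of_lt h hx

theorem smul_sphere_mem_exterior {R r : ℝ} (hR : 0 ≤ R) (hr : R < r)
    (z : Metric.sphere (0 : Coord n) 1) : r • (z : Coord n) ∈ exterior n R := by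
  have : ‖r • (z : Coord n)‖ = r := by
    rw [norm_smul, norm_eq_of_mem_sphere, mul_one, Real.norm_of_nonneg (hR.trans hr.le)]
  simpa [exterior, this] using hr

theorem norm_smul_sphere {r : ℝ} (hr : 0 ≤ r) (z : Metric.sphere (0 : Coord n) 1) :
    ‖r • (z : Coord n)‖ = r := by
  rw [norm_smul, norm_eq_of_mem_sphere, mul_one, Real.norm_of_nonneg hr]

theorem integrable_sphere_of_continuousOn {R r : ℝ} (hR : 0 ≤ R) (hr : R < r) {F : Coord n → ℝ}
    (hF : ContinuousOn F (exterior n R)) :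
    Integrable (fun z : Metric.sphere (0 : Coord n) 1 => F (r • (z : Coord n)))
      (volume : Measure (Coord n)).toSphere := by
  refine Continuous.integrable_of_hasCompactSupport ?_ (HasCompactSupport.of_compactSpace _)
  exact hF.comp_continuous (by fun_prop) fun z => smul_sphere_mem_exterior hR hr z

theorem sphereIntegral_sub {R r : ℝ} (hR : 0 ≤ R) (hr : R < r) {F F' : Coord n → ℝ}
    (hF : ContinuousOn F (exterior n R)) (hF' : ContinuousOn F' (exterior n R)) :
    sphereIntegral r (fun x => F x - F' x) = sphereIntegral r F - sphereIntegral r F' := by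
  unfold sphereIntegral
  rw [integral_sub (integrable_sphere_of_continuousOn hR hr hF)
    (integrable_sphere_of_continuousOn hR hr hF'), mul_sub]

theorem sphereIntegral_const_mul (r c : ℝ) (F : Coord n → ℝ) :
    sphereIntegral r (fun x => c * F x) = c * sphereIntegral r F := by
  unfold sphereIntegral
  rw [integral_const_mul, mul_left_comm]

theorem sphereIntegral_sum {ι : Type*} (s : Finset ι) {R r : ℝ} (hR : 0 ≤ R) (hr : R < r)
    {F : ι → Coord n → ℝ} (hF : ∀ i ∈ s, ContinuousOn (F i) (exterior n R)) :
    sphereIntegral r (fun x => ∑ i ∈ s, F i x) = ∑ i ∈ s, sphereIntegral r (F i) := by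
  unfold sphereIntegral
  rw [integral_finsetSum s fun i hi => integrable_sphere_of_continuousOn hR hr (hF i hi),
    Finset.mul_sum]

theorem sphereIntegral_congr {r : ℝ} (hr : 0 ≤ r) {F F' : Coord n → ℝ}
    (h : ∀ x : Coord n, ‖x‖ = r → F x = F' x) : sphereIntegral r F = sphereIntegral r F' := by
  unfold sphereIntegral
  congr 1
  exact integral_congr_ae (Eventually.of_forall fun z => h _ (norm_smul_sphere hr z))

theorem continuousOn_sphereIntegral {R : ℝ} (hR : 0 ≤ R) {F : Coord n → ℝ}
    (hF : ContinuousOn F (exterior n R)) :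
    ContinuousOn (fun r => sphereIntegral r F) (Set.Ioi R) := by
  unfold sphereIntegral
  refine (continuousOn_id.pow _).mul ?_
  refine continuousOn_integral_of_compact_support isCompact_univ ?_
    (fun _ x _ hx => absurd (Set.mem_univ x) hx)
  exact hF.comp (by fun_prop) fun p hp => smul_sphere_mem_exterior hR hp.1 p.2

/-- Integration in polar coordinates. -/
theorem integral_eq_integral_sphereIntegral (hn : 0 < n) {f : Coord n → ℝ} (hf : Integrable f) :
    ∫ x, f x = ∫ r in Set.Ioi (0 : ℝ), sphereIntegral r f := by
  have : Nonempty (Fin n) := ⟨⟨0, hn⟩⟩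
  have hmp := (volume : Measure (Coord n)).measurePreserving_homeomorphUnitSphereProd
  have hdim : Module.finrank ℝ (Coord n) = n := finrank_euclideanSpace_fin
  rw [hdim] at hmp
  let g : Metric.sphere (0 : Coord n) 1 × Set.Ioi (0 : ℝ) → ℝ := fun p => f (p.2.1 • p.1.1)
  have hg : ∀ x : ({0}ᶜ : Set (Coord n)), g (homeomorphUnitSphereProd (Coord n) x) = f x := by
    intro x
    have hx : ‖(x : Coord n)‖ ≠ 0 := by simpa [-Subtype.coe_prop] using x.2
    simp [g, smul_smul, hx]
  have hemb := (homeomorphUnitSphereProd (Coord n)).measurableEmbedding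
  have h1 : ∫ x, f x = ∫ p, g p ∂((volume : Measure (Coord n)).toSphere.prod
      (Measure.volumeIoiPow (n - 1))) := by
    rw [← hmp.integral_comp hemb]
    simp only [hg]
    rw [integral_subtype_comap (measurableSet_singleton _).compl f, restrict_compl_singleton]
  have hgi : Integrable g ((volume : Measure (Coord n)).toSphere.prod
      (Measure.volumeIoiPow (n - 1))) := by
    rw [← hmp.integrable_comp_emb hemb]
    have : g ∘ homeomorphUnitSphereProd (Coord n) =
        fun x : ({0}ᶜ : Set (Coord n)) => f x := funext hg
    rw [this]
    have := hf.integrableOn (s := ({0}ᶜ : Set (Coord n)))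
    rwa [integrableOn_iff_comap_subtypeVal (measurableSet_singleton _).compl] at this
  rw [h1, integral_prod_symm _ hgi]
  simp only [Measure.volumeIoiPow, ENNReal.ofReal]
  rw [integral_withDensity_eq_integral_smul
    ((measurable_subtype_coe.pow_const _).real_toNNReal)]
  rw [integral_subtype_comap measurableSet_Ioi fun a : ℝ =>
    Real.toNNReal (a ^ (n - 1)) • ∫ z : Metric.sphere (0 : Coord n) 1, f (a • (z : Coord n))
      ∂(volume : Measure (Coord n)).toSphere]
  refine setIntegral_congr_fun measurableSet_Ioi fun r hr => ?_
  have hr' : (0 : ℝ) < r := hr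
  simp only [sphereIntegral, NNReal.smul_def, Real.coe_toNNReal _ (pow_nonneg hr'.le (n - 1)),
    smul_eq_mul]

theorem hasFDerivAt_norm_of_ne_zero {x : Coord n} (hx : x ≠ 0) :
    HasFDerivAt (fun y : Coord n => ‖y‖) (‖x‖⁻¹ • innerSL ℝ x) x := by
  have h := ((hasStrictFDerivAt_norm_sq x).hasFDerivAt).sqrt (by simpa using hx)
  simp only [Real.sqrt_sq (norm_nonneg _)] at h
  refine h.congr_fderiv ?_
  ext v
  simp
  field_simp

/-- Radial test functions on an exterior domain. -/
theorem radial_testFunction {R : ℝ} (hR : 0 ≤ R) {χ : ℝ → ℝ} (hχ : ContDiff ℝ 1 χ)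
    (hc : HasCompactSupport χ) (hs : tsupport χ ⊆ Set.Ioi R) :
    ContDiff ℝ 1 (fun x : Coord n => χ ‖x‖) ∧ HasCompactSupport (fun x : Coord n => χ ‖x‖) ∧
      tsupport (fun x : Coord n => χ ‖x‖) ⊆ exterior n R ∧
      ∀ i (x : Coord n), pderiv i (fun x : Coord n => χ ‖x‖) x = deriv χ ‖x‖ * (x i / ‖x‖) := by
  have hsub : tsupport (fun x : Coord n => χ ‖x‖) ⊆ (fun x : Coord n => ‖x‖) ⁻¹' tsupport χ :=
    tsupport_comp_subset_preimage χ continuous_norm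
  have h0 : (fun x : Coord n => χ ‖x‖) =ᶠ[𝓝 0] fun _ => 0 := by
    have h1 : (0 : Coord n) ∉ tsupport (fun x : Coord n => χ ‖x‖) := fun h => by
      have := hs (hsub h)
      simp only [norm_zero, Set.mem_Ioi] at this
      linarith
    exact notMem_tsupport_iff_eventuallyEq.1 h1
  refine ⟨?_, ?_, ?_, ?_⟩
  · refine contDiff_iff_contDiffAt.2 fun x => ?_
    by_cases hx : x = 0
    · subst hx
      exact contDiffAt_const.congr_of_eventuallyEq h0
    · exact hχ.contDiffAt.comp x (contDiffAt_norm ℝ hx)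
  · obtain ⟨B, hB⟩ := hc.isBounded.exists_norm_le
    refine (isCompact_closedBall (0 : Coord n) B).of_isClosed_subset (isClosed_tsupport _) ?_
    intro x hx
    simpa using hB _ (hsub hx)
  · exact hsub.trans fun x hx => hs hx
  · intro i x
    by_cases hx : x = 0
    · subst hx
      have : fderiv ℝ (fun x : Coord n => χ ‖x‖) 0 = 0 := by
        rw [h0.fderiv_eq]; simp
      simp [pderiv, this]
    · have h1 := (hχ.differentiable one_ne_zero ‖x‖).hasDerivAt.comp_hasFDerivAt x
        (hasFDerivAt_norm_of_ne_zero hx)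
      have h2 : fderiv ℝ (fun x : Coord n => χ ‖x‖) x = _ := h1.fderiv
      rw [pderiv, h2]
      simp [coordVec, EuclideanSpace.inner_single_right, div_eq_inv_mul]

end Spheres

/-! ### The flux of a curl -/

section Curl

variable {n : ℕ}

theorem ContDiffOn.continuousOn_pderiv {U : Set (Coord n)} (hU : IsOpen U) {u : Coord n → ℝ}
    (hu : ContDiffOn ℝ 1 u U) (i : Fin n) : ContinuousOn (pderiv i u) U :=
  (hu.continuousOn_fderiv_of_isOpen hU le_rfl).clm_apply continuousOn_const

theorem pderiv_mul {i : Fin n} {u v : Coord n → ℝ} {x : Coord n} (hu : DifferentiableAt ℝ u x)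
    (hv : DifferentiableAt ℝ v x) :
    pderiv i (fun y => u y * v y) x = u x * pderiv i v x + pderiv i u x * v x := by
  simp only [pderiv, fderiv_fun_mul hu hv]
  simp
  ring

theorem pderiv_sum {ι : Type*} (s : Finset ι) {k : Fin n} {f : ι → Coord n → ℝ} {x : Coord n}
    (hf : ∀ h ∈ s, DifferentiableAt ℝ (f h) x) :
    pderiv k (fun y => ∑ h ∈ s, f h y) x = ∑ h ∈ s, pderiv k (f h) x := by
  simp only [pderiv]
  rw [fderiv_fun_sum hf]
  simp

theorem pderiv_coord (i j : Fin n) (x : Coord n) :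
    pderiv i (fun y => y j) x = (1 : Matrix (Fin n) (Fin n) ℝ) i j := by
  have h : HasFDerivAt (fun y : Coord n => y j) (EuclideanSpace.proj (𝕜 := ℝ) j) x :=
    (EuclideanSpace.proj (𝕜 := ℝ) j).hasFDerivAt
  rw [pderiv, h.fderiv]
  simp [coordVec, Matrix.one_apply, eq_comm]

/-- Polar coordinates for the product of a function with a radial test function. -/
theorem integral_mul_radial {R : ℝ} (hn : 0 < n) (hR : 0 ≤ R) {F : Coord n → ℝ} {χ : ℝ → ℝ}
    (hχi : Integrable (fun x : Coord n => χ ‖x‖ * F x)) (hs : tsupport χ ⊆ Set.Ioi R) :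
    ∫ x, χ ‖x‖ * F x = ∫ r, χ r * sphereIntegral r F := by
  rw [integral_eq_integral_sphereIntegral hn hχi, ← integral_indicator measurableSet_Ioi]
  refine integral_congr_ae (Eventually.of_forall fun r => ?_)
  simp only [Set.indicator_apply, Set.mem_Ioi]
  split_ifs with hr
  · rw [← sphereIntegral_const_mul]
    exact sphereIntegral_congr hr.le fun x hx => by rw [hx]
  · have : χ r = 0 := by
      by_contra h
      have := hs (subset_tsupport _ h)
      exact hr (hR.trans_lt this)
    simp [this]

/-- The rotation fields are tangent to the spheres and divergence free, so derivatives along them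
integrate to zero over spheres. -/
theorem sphereIntegral_rotation_eq_zero {R : ℝ} (hn : 0 < n) (hR : 0 ≤ R) {f : Coord n → ℝ}
    (hf : ContDiffOn ℝ 1 f (exterior n R)) (i j : Fin n) {r : ℝ} (hr : R < r) :
    sphereIntegral r (fun x => x i * pderiv j f x - x j * pderiv i f x) = 0 := by
  have hcoord : ∀ i : Fin n, ContDiff ℝ 1 fun x : Coord n => x i := fun i =>
    (EuclideanSpace.proj (𝕜 := ℝ) i).contDiff
  have hF : ContinuousOn (fun x => x i * pderiv j f x - x j * pderiv i f x) (exterior n R) :=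
    ((hcoord i).continuous.continuousOn.mul (hf.continuousOn_pderiv (isOpen_exterior n R) j)).sub
      ((hcoord j).continuous.continuousOn.mul (hf.continuousOn_pderiv (isOpen_exterior n R) i))
  refine eq_zero_on_Ioi_of_integral_mul_eq_zero (continuousOn_sphereIntegral hR hF) ?_ hr
  intro χ hχ hc hs
  have hχ1 : ContDiff ℝ 1 χ := hχ.of_le (by norm_cast)
  obtain ⟨h1, h2, h3, h4⟩ := radial_testFunction (n := n) hR hχ1 hc hs
  have hUo := isOpen_exterior n R
  have hint : ∀ {G : Coord n → ℝ}, ContinuousOn G (exterior n R) →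
      Integrable fun x : Coord n => χ ‖x‖ * G x := by
    intro G hG
    simpa only [mul_comm] using
      hG.integrable_mul_of_tsupport_subset (μ := volume) hUo.measurableSet h1.continuous h2 h3
  rw [← integral_mul_radial hn hR (hint hF) hs]
  have key : ∀ i j : Fin n, ∫ x, χ ‖x‖ * (x i * pderiv j f x) =
      -∫ x, f x * ((1 : Matrix (Fin n) (Fin n) ℝ) j i * χ ‖x‖ +
        deriv χ ‖x‖ * (x i * x j / ‖x‖)) := by
    intro i j
    have hsub : tsupport (fun x : Coord n => x i * χ ‖x‖) ⊆ tsupport fun x : Coord n => χ ‖x‖ :=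
      tsupport_mul_subset_right
    have hibp := integral_mul_fderiv_eq_neg_of_tsupport_subset (μ := volume) hUo hf
      ((hcoord i).mul h1) (h2.of_isClosed_subset (isClosed_tsupport _) hsub) (hsub.trans h3)
      (coordVec j)
    have e1 : ∀ x : Coord n, fderiv ℝ (fun x : Coord n => x i * χ ‖x‖) x (coordVec j) =
        (1 : Matrix (Fin n) (Fin n) ℝ) j i * χ ‖x‖ + deriv χ ‖x‖ * (x i * x j / ‖x‖) := by
      intro x
      have := pderiv_mul (i := j) ((hcoord i).differentiable one_ne_zero x)
        (h1.differentiable one_ne_zero x)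
      rw [pderiv_coord, h4 j x] at this
      refine this.trans ?_
      ring
    simp only [e1] at hibp
    rw [hibp, neg_neg]
    refine integral_congr_ae (Eventually.of_forall fun x => ?_)
    simp only [pderiv]
    ring
  have hsymm : (1 : Matrix (Fin n) (Fin n) ℝ) j i = (1 : Matrix (Fin n) (Fin n) ℝ) i j := by
    simp [Matrix.one_apply, eq_comm]
  simp only [mul_sub]
  have hint' : ∀ i j, Integrable fun x : Coord n => χ ‖x‖ * (x i * pderiv j f x) := fun i j =>
    hint (G := fun x => x i * pderiv j f x)
      ((hcoord i).continuous.continuousOn.mul (hf.continuousOn_pderiv hUo j))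
  rw [integral_sub (hint' i j) (hint' j i), key i j, key j i, hsymm]
  simp only [mul_comm]
  ring

/-- The flux through a sphere of the divergence `∑ⱼ ∂ⱼF_{ij}` of an antisymmetric matrix field
vanishes. -/
theorem sphereIntegral_curl_eq_zero {R : ℝ} (hn : 0 < n) (hR : 0 ≤ R)
    {F : Fin n → Fin n → Coord n → ℝ} (hF : ∀ i j, ContDiffOn ℝ 1 (F i j) (exterior n R))
    (hanti : ∀ i j x, F j i x = -F i j x) {r : ℝ} (hr : R < r) :
    sphereIntegral r (fun x => ∑ i, ∑ j, pderiv j (F i j) x * (x i / ‖x‖)) = 0 := by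
  have hr0 : 0 < r := hR.trans_lt hr
  have hpd : ∀ i j x, pderiv i (F j i) x = -pderiv i (F i j) x := by
    intro i j x
    have : F j i = fun y => -F i j y := funext (hanti i j)
    rw [this, pderiv, fderiv_fun_neg, pderiv]
    simp
  have hcont : ∀ i j, ContinuousOn (fun x : Coord n => x i * pderiv j (F i j) x
      - x j * pderiv i (F i j) x) (exterior n R) := by
    intro i j
    have hcoord : ∀ i : Fin n, Continuous fun x : Coord n => x i := fun i => by fun_prop
    exact ((hcoord i).continuousOn.mul ((hF i j).continuousOn_pderiv (isOpen_exterior n R) j)).sub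
      ((hcoord j).continuousOn.mul ((hF i j).continuousOn_pderiv (isOpen_exterior n R) i))
  have h1 : sphereIntegral r (fun x => ∑ i, ∑ j, pderiv j (F i j) x * (x i / ‖x‖)) =
      sphereIntegral r fun x => 1 / (2 * r) * ∑ i, ∑ j, (x i * pderiv j (F i j) x
        - x j * pderiv i (F i j) x) := by
    refine sphereIntegral_congr hr0.le fun x hx => ?_
    have h2 : ∑ i, ∑ j, x j * pderiv i (F i j) x = -∑ i, ∑ j, x i * pderiv j (F i j) x := by
      rw [Finset.sum_comm, ← Finset.sum_neg_distrib]
      refine Finset.sum_congr rfl fun i _ => ?_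
      rw [← Finset.sum_neg_distrib]
      refine Finset.sum_congr rfl fun j _ => ?_
      rw [hpd j i x, neg_mul_eq_mul_neg, neg_neg]
    simp only [Finset.sum_sub_distrib]
    rw [h2, hx, sub_neg_eq_add, ← two_mul, Finset.mul_sum, Finset.mul_sum]
    refine Finset.sum_congr rfl fun i _ => ?_
    rw [Finset.mul_sum, Finset.mul_sum]
    refine Finset.sum_congr rfl fun j _ => ?_
    field_simp
  rw [h1, sphereIntegral_const_mul, sphereIntegral_sum _ hR hr fun i _ =>
    continuousOn_finsetSum _ fun j _ => hcont i j]
  rw [Finset.sum_eq_zero, mul_zero]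
  intro i _
  rw [sphereIntegral_sum _ hR hr fun j _ => hcont i j]
  exact Finset.sum_eq_zero fun j _ => sphereIntegral_rotation_eq_zero hn hR (hF i j) i j hr

end Curl

/-! ### Asymptotically constant functions -/

section AsymptoticallyConstant

open Asymptotics Bornology

variable {n : ℕ}

theorem eventually_cobounded_iff {p : Coord n → Prop} :
    (∀ᶠ x in cobounded (Coord n), p x) ↔ ∃ R : ℝ, ∀ x ∈ exterior n R, p x := by
  rw [← comap_norm_atTop, (atTop_basis_Ioi.comap _).eventually_iff]
  simp [exterior]

theorem eventually_exterior (R : ℝ) : ∀ᶠ x in cobounded (Coord n), x ∈ exterior n R :=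
  eventually_cobounded_iff.2 ⟨R, fun _ h => h⟩

theorem eventually_cobounded_eventually_nhds {p : Coord n → Prop}
    (h : ∀ᶠ x in cobounded (Coord n), p x) : ∀ᶠ x in cobounded (Coord n), ∀ᶠ y in 𝓝 x, p y := by
  obtain ⟨R, hR⟩ := eventually_cobounded_iff.1 h
  refine eventually_cobounded_iff.2 ⟨R, fun x hx => ?_⟩
  filter_upwards [(isOpen_exterior n R).mem_nhds hx] with y hy using hR y hy

/-- The power `r^{-β}` of the radius. -/
noncomputable def rpowNeg (n : ℕ) (β : ℝ) (x : Coord n) : ℝ := ‖x‖ ^ (-β)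

theorem rpowNeg_nonneg (β : ℝ) (x : Coord n) : 0 ≤ rpowNeg n β x := by
  unfold rpowNeg; positivity

theorem tendsto_rpowNeg {β : ℝ} (hβ : 0 < β) :
    Tendsto (rpowNeg n β) (cobounded (Coord n)) (𝓝 0) :=
  (tendsto_rpow_neg_atTop hβ).comp tendsto_norm_cobounded_atTop

theorem rpowNeg_isLittleO_one {β : ℝ} (hβ : 0 < β) :
    rpowNeg n β =o[cobounded (Coord n)] fun _ => (1 : ℝ) :=
  (isLittleO_one_iff ℝ).2 (tendsto_rpowNeg hβ)

theorem rpowNeg_mul_eventuallyEq (α β : ℝ) :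
    (fun x => rpowNeg n α x * rpowNeg n β x) =ᶠ[cobounded (Coord n)] rpowNeg n (α + β) := by
  filter_upwards [eventually_exterior 0] with x hx
  have hx' : 0 < ‖x‖ := hx
  rw [rpowNeg, rpowNeg, rpowNeg, ← Real.rpow_add hx']
  ring_nf

/-- `f` is asymptotically equal to the constant `c` at the rate of an asymptotically Euclidean
metric: `f - c = O(r^{2-n})` and `∂f = O(r^{1-n})`. -/
structure IsAsympConst (f : Coord n → ℝ) (c : ℝ) : Prop where
  contDiffAt : ∀ᶠ x in cobounded (Coord n), ContDiffAt ℝ 1 f x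
  sub_isBigO : (fun x => f x - c) =O[cobounded (Coord n)] rpowNeg n ((n : ℝ) - 2)
  fderiv_isBigO : fderiv ℝ f =O[cobounded (Coord n)] rpowNeg n ((n : ℝ) - 1)

namespace IsAsympConst

variable {f g : Coord n → ℝ} {c d : ℝ}

theorem differentiableAt (hf : IsAsympConst f c) :
    ∀ᶠ x in cobounded (Coord n), DifferentiableAt ℝ f x := by
  filter_upwards [hf.contDiffAt] with x hx using hx.differentiableAt one_ne_zero

theorem continuousAt (hf : IsAsympConst f c) :
    ∀ᶠ x in cobounded (Coord n), ContinuousAt f x := by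
  filter_upwards [hf.contDiffAt] with x hx using hx.continuousAt

theorem continuousAt_pderiv (hf : IsAsympConst f c) (i : Fin n) :
    ∀ᶠ x in cobounded (Coord n), ContinuousAt (pderiv i f) x := by
  filter_upwards [hf.contDiffAt] with x hx
  exact (hx.continuousAt_fderiv one_ne_zero).clm_apply continuousAt_const

theorem pderiv_isBigO (hf : IsAsympConst f c) (i : Fin n) :
    pderiv i f =O[cobounded (Coord n)] rpowNeg n ((n : ℝ) - 1) := by
  refine (IsBigO.of_bound ‖(coordVec i : Coord n)‖ (Eventually.of_forall fun x => ?_)).trans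
    hf.fderiv_isBigO
  rw [mul_comm]
  exact (fderiv ℝ f x).le_opNorm _

theorem tendsto (hn : 2 < n) (hf : IsAsympConst f c) :
    Tendsto f (cobounded (Coord n)) (𝓝 c) := by
  have hn' : (2 : ℝ) < n := by exact_mod_cast hn
  have := hf.sub_isBigO.trans_tendsto (tendsto_rpowNeg (n := n) (by linarith))
  simpa using this.add_const c

theorem isBigO_one (hn : 2 < n) (hf : IsAsympConst f c) :
    f =O[cobounded (Coord n)] fun _ => (1 : ℝ) :=
  (hf.tendsto hn).isBigO_one ℝ

theorem const (c : ℝ) : IsAsympConst (fun _ : Coord n => c) c where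
  contDiffAt := Eventually.of_forall fun _ => contDiffAt_const
  sub_isBigO := by simpa using isBigO_zero _ _
  fderiv_isBigO := by
    have : fderiv ℝ (fun _ : Coord n => c) = fun _ => 0 := by ext; simp
    rw [this]
    exact isBigO_zero _ _

theorem congr (hf : IsAsympConst f c) (h : f =ᶠ[cobounded (Coord n)] g) : IsAsympConst g c := by
  have h' := eventually_cobounded_eventually_nhds h
  refine ⟨?_, ?_, ?_⟩
  · filter_upwards [hf.contDiffAt, h'] with x hx hy
    exact hx.congr_of_eventuallyEq (EventuallyEq.symm hy)
  · exact hf.sub_isBigO.congr' (h.mono fun x hx => by simp [hx]) EventuallyEq.rfl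
  · exact hf.fderiv_isBigO.congr' (h'.mono fun x hx => EventuallyEq.fderiv_eq hx) EventuallyEq.rfl

theorem add (hf : IsAsympConst f c) (hg : IsAsympConst g d) :
    IsAsympConst (fun x => f x + g x) (c + d) where
  contDiffAt := by filter_upwards [hf.contDiffAt, hg.contDiffAt] with x h1 h2 using h1.add h2
  sub_isBigO := (hf.sub_isBigO.add hg.sub_isBigO).congr_left fun x => by ring
  fderiv_isBigO := by
    refine (hf.fderiv_isBigO.add hg.fderiv_isBigO).congr' ?_ EventuallyEq.rfl
    filter_upwards [hf.differentiableAt, hg.differentiableAt] with x h1 h2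
    rw [fderiv_fun_add h1 h2]

theorem mul (hn : 2 < n) (hf : IsAsympConst f c) (hg : IsAsympConst g d) :
    IsAsympConst (fun x => f x * g x) (c * d) where
  contDiffAt := by filter_upwards [hf.contDiffAt, hg.contDiffAt] with x h1 h2 using h1.mul h2
  sub_isBigO := by
    have h1 := (hf.isBigO_one hn).mul hg.sub_isBigO
    have h2 := hf.sub_isBigO.const_mul_left d
    simp only [one_mul] at h1
    exact (h1.add h2).congr_left fun x => by ring
  fderiv_isBigO := by
    have h1 := (hf.isBigO_one hn).smul hg.fderiv_isBigO
    have h2 := (hg.isBigO_one hn).smul hf.fderiv_isBigO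
    simp only [one_smul] at h1 h2
    refine (h1.add h2).congr' ?_ EventuallyEq.rfl
    filter_upwards [hf.differentiableAt, hg.differentiableAt] with x h1 h2
    rw [fderiv_fun_mul h1 h2]

theorem const_mul (hn : 2 < n) (a : ℝ) (hf : IsAsympConst f c) :
    IsAsympConst (fun x => a * f x) (a * c) :=
  (const a).mul hn hf

theorem sum {ι : Type*} (s : Finset ι) {f : ι → Coord n → ℝ} {c : ι → ℝ}
    (hf : ∀ i ∈ s, IsAsympConst (f i) (c i)) :
    IsAsympConst (fun x => ∑ i ∈ s, f i x) (∑ i ∈ s, c i) := by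
  classical
  induction s using Finset.induction_on with
  | empty => simpa using const 0
  | insert a s ha ih =>
    simp only [Finset.sum_insert ha]
    exact (hf a (Finset.mem_insert_self a s)).add
      (ih fun i hi => hf i (Finset.mem_insert_of_mem hi))

theorem prod (hn : 2 < n) {ι : Type*} (s : Finset ι) {f : ι → Coord n → ℝ} {c : ι → ℝ}
    (hf : ∀ i ∈ s, IsAsympConst (f i) (c i)) :
    IsAsympConst (fun x => ∏ i ∈ s, f i x) (∏ i ∈ s, c i) := by
  classical
  induction s using Finset.induction_on with
  | empty => simpa using const 1
  | insert a s ha ih =>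
    simp only [Finset.prod_insert ha]
    exact (hf a (Finset.mem_insert_self a s)).mul hn
      (ih fun i hi => hf i (Finset.mem_insert_of_mem hi))

theorem comp (hn : 2 < n) (hf : IsAsympConst f c) {φ : ℝ → ℝ} (hφ : ContDiffAt ℝ 1 φ c) :
    IsAsympConst (fun x => φ (f x)) (φ c) where
  contDiffAt := by
    filter_upwards [hf.contDiffAt, (hf.tendsto hn).eventually (hφ.eventually (by simp))]
      with x h1 h2 using h2.comp x h1
  sub_isBigO :=
    ((hφ.differentiableAt one_ne_zero).isBigO_sub.comp_tendsto (hf.tendsto hn)).trans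
      hf.sub_isBigO
  fderiv_isBigO := by
    have hd : (fun x => fderiv ℝ φ (f x)) =O[cobounded (Coord n)] fun _ => (1 : ℝ) :=
      ((hφ.continuousAt_fderiv one_ne_zero).tendsto.comp (hf.tendsto hn)).isBigO_one ℝ
    have h1 : (fun x => (fderiv ℝ φ (f x)).comp (fderiv ℝ f x)) =O[cobounded (Coord n)]
        fun x => ‖fderiv ℝ φ (f x)‖ * ‖fderiv ℝ f x‖ :=
      IsBigO.of_bound 1 (Eventually.of_forall fun x => by
        simpa using ContinuousLinearMap.opNorm_comp_le (fderiv ℝ φ (f x)) (fderiv ℝ f x))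
    have h2 := h1.trans (hd.norm_left.mul hf.fderiv_isBigO.norm_left)
    simp only [one_mul] at h2
    refine h2.congr' ?_ EventuallyEq.rfl
    filter_upwards [hf.differentiableAt, (hf.tendsto hn).eventually (hφ.eventually (by simp))]
      with x h3 h4
    exact (fderiv_comp x (h4.differentiableAt one_ne_zero) h3).symm

theorem det (hn : 2 < n) {m : ℕ} {M : Coord n → Matrix (Fin m) (Fin m) ℝ}
    {C : Matrix (Fin m) (Fin m) ℝ} (hM : ∀ i j, IsAsympConst (fun x => M x i j) (C i j)) :
    IsAsympConst (fun x => (M x).det) C.det := by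
  simp only [Matrix.det_apply, Units.smul_def, zsmul_eq_mul]
  exact sum _ fun σ _ => const_mul hn _ (prod hn _ fun i _ => hM _ _)

theorem inv (hn : 2 < n) {m : ℕ} {M : Coord n → Matrix (Fin m) (Fin m) ℝ}
    (hM : ∀ i j, IsAsympConst (fun x => M x i j) ((1 : Matrix (Fin m) (Fin m) ℝ) i j))
    (i j : Fin m) :
    IsAsympConst (fun x => (M x)⁻¹ i j) ((1 : Matrix (Fin m) (Fin m) ℝ) i j) := by
  have hadj : IsAsympConst (fun x => (M x).adjugate i j)
      ((1 : Matrix (Fin m) (Fin m) ℝ).adjugate i j) := by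
    simp only [Matrix.adjugate_apply]
    refine det hn fun k l => ?_
    simp only [Matrix.updateRow_apply]
    split_ifs
    · exact const _
    · exact hM k l
  have hdet := (det hn hM).comp hn (φ := fun t => t⁻¹)
    (contDiffAt_inv ℝ (by rw [Matrix.det_one]; exact one_ne_zero))
  have := hdet.mul hn hadj
  rw [Matrix.adjugate_one, Matrix.det_one, inv_one, one_mul] at this
  refine this.congr (Eventually.of_forall fun x => ?_)
  simp [Matrix.inv_def]

theorem sqrt_det (hn : 2 < n) {m : ℕ} {M : Coord n → Matrix (Fin m) (Fin m) ℝ}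
    (hM : ∀ i j, IsAsympConst (fun x => M x i j) ((1 : Matrix (Fin m) (Fin m) ℝ) i j)) :
    IsAsympConst (fun x => Real.sqrt (M x).det) 1 := by
  have := (det hn hM).comp hn (φ := Real.sqrt)
    (Real.contDiffAt_sqrt (by rw [Matrix.det_one]; exact one_ne_zero))
  rwa [Matrix.det_one, Real.sqrt_one] at this

end IsAsympConst

/-- Functions in `C¹_{n-2}` near infinity, shifted by a constant. -/
theorem MemCkβ.isAsympConst {R : ℝ} {f u : Coord n → ℝ} {c : ℝ}
    (hu : MemCkβ (exterior n R) 1 ((n : ℝ) - 2) u)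
    (h : u =ᶠ[cobounded (Coord n)] fun x => f x - c) : IsAsympConst f c := by
  have hux : IsAsympConst u 0 := by
    obtain ⟨hd, C, hC⟩ := hu
    refine ⟨eventually_cobounded_iff.2 ⟨R, fun x hx => ?_⟩, ?_, ?_⟩
    · exact hd.contDiffAt ((isOpen_exterior n R).mem_nhds hx)
    · refine IsBigO.of_bound C ?_
      filter_upwards [eventually_exterior R, eventually_exterior 0] with x hx hx0
      have hx0' : 0 < ‖x‖ := hx0
      have := hC 0 zero_le_one x hx
      rw [norm_iteratedFDeriv_zero] at this
      rw [sub_zero, Real.norm_of_nonneg (rpowNeg_nonneg _ _), rpowNeg, Real.rpow_neg hx0'.le,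
        ← div_eq_mul_inv, le_div_iff₀ (by positivity), mul_comm]
      simpa using this
    · refine IsBigO.of_bound C ?_
      filter_upwards [eventually_exterior R, eventually_exterior 0] with x hx hx0
      have hx0' : 0 < ‖x‖ := hx0
      have := hC 1 le_rfl x hx
      rw [norm_iteratedFDeriv_one] at this
      rw [Real.norm_of_nonneg (rpowNeg_nonneg _ _), rpowNeg, Real.rpow_neg hx0'.le,
        ← div_eq_mul_inv, le_div_iff₀ (by positivity), mul_comm]
      have e : (n : ℝ) - 1 = n - 2 + (1 : ℕ) := by push_cast; ring
      rwa [e]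
  have := hux.add (IsAsympConst.const c)
  rw [zero_add] at this
  exact this.congr (h.mono fun x hx => by simp [hx])

end AsymptoticallyConstant

/-! ### Flux densities up to terms with vanishing flux at infinity -/

section Flux

open Asymptotics Bornology

variable {n : ℕ}

/-- Two flux densities of size `O(r^{1-n})`, continuous near infinity, that differ by `o(r^{1-n})`;
their integrals over large spheres agree in the limit. -/
structure FluxEquiv (f g : Coord n → ℝ) : Prop where
  continuousAt_left : ∀ᶠ x in cobounded (Coord n), ContinuousAt f x
  continuousAt_right : ∀ᶠ x in cobounded (Coord n), ContinuousAt g x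
  isBigO : g =O[cobounded (Coord n)] rpowNeg n ((n : ℝ) - 1)
  sub_isLittleO : (fun x => f x - g x) =o[cobounded (Coord n)] rpowNeg n ((n : ℝ) - 1)

theorem norm_sphereIntegral_le {r c : ℝ} (hn : 0 < n) (hr : 0 < r) {f : Coord n → ℝ}
    (hf : ∀ x : Coord n, ‖x‖ = r → ‖f x‖ ≤ c * rpowNeg n ((n : ℝ) - 1) x) :
    ‖sphereIntegral r f‖ ≤ c * (volume : Measure (Coord n)).toSphere.real Set.univ := by
  have h1 : ‖∫ z : Metric.sphere (0 : Coord n) 1, f (r • (z : Coord n))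
      ∂((volume : Measure (Coord n)).toSphere)‖ ≤
      c * r ^ (-((n : ℝ) - 1)) * (volume : Measure (Coord n)).toSphere.real Set.univ := by
    refine norm_integral_le_of_norm_le_const (Eventually.of_forall fun z => ?_)
    have := hf (r • (z : Coord n)) (norm_smul_sphere hr.le z)
    rwa [rpowNeg, norm_smul_sphere hr.le z] at this
  have h2 : r ^ (n - 1) * r ^ (-((n : ℝ) - 1)) = 1 := by
    have e : ((n - 1 : ℕ) : ℝ) = (n : ℝ) - 1 := by
      rw [Nat.cast_sub hn, Nat.cast_one]
    rw [← Real.rpow_natCast, e, ← Real.rpow_add hr, add_neg_cancel, Real.rpow_zero]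
  rw [sphereIntegral, norm_mul, Real.norm_of_nonneg (by positivity)]
  calc _ ≤ r ^ (n - 1) * (c * r ^ (-((n : ℝ) - 1)) *
        (volume : Measure (Coord n)).toSphere.real Set.univ) :=
        mul_le_mul_of_nonneg_left h1 (by positivity)
    _ = c * (r ^ (n - 1) * r ^ (-((n : ℝ) - 1))) *
        (volume : Measure (Coord n)).toSphere.real Set.univ := by ring
    _ = _ := by rw [h2, mul_one]

theorem tendsto_sphereIntegral_of_isLittleO (hn : 0 < n) {f : Coord n → ℝ}
    (hf : f =o[cobounded (Coord n)] rpowNeg n ((n : ℝ) - 1)) :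
    Tendsto (fun r => sphereIntegral r f) atTop (𝓝 0) := by
  let a := (volume : Measure (Coord n)).toSphere.real Set.univ
  have ha : 0 ≤ a := measureReal_nonneg
  refine Metric.tendsto_nhds.2 fun ε hε => ?_
  have hc : 0 < ε / (a + 1) := by positivity
  obtain ⟨R, hR⟩ := eventually_cobounded_iff.1 (hf.def hc)
  filter_upwards [eventually_gt_atTop R, eventually_gt_atTop 0] with r hr hr0
  rw [dist_zero_right]
  refine (norm_sphereIntegral_le (c := ε / (a + 1)) hn hr0 fun x hx => ?_).trans_lt ?_
  · have := hR x (by simpa [exterior, hx] using hr)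
    rwa [Real.norm_of_nonneg (rpowNeg_nonneg _ _)] at this
  · change ε / (a + 1) * a < ε
    rw [div_mul_eq_mul_div, div_lt_iff₀ (by positivity)]
    nlinarith

theorem exists_norm_sphereIntegral_le (hn : 0 < n) {f : Coord n → ℝ}
    (hf : f =O[cobounded (Coord n)] rpowNeg n ((n : ℝ) - 1)) :
    ∃ C, ∀ᶠ r in atTop, ‖sphereIntegral r f‖ ≤ C := by
  obtain ⟨c, hc⟩ := hf.bound
  obtain ⟨R, hR⟩ := eventually_cobounded_iff.1 hc
  refine ⟨c * (volume : Measure (Coord n)).toSphere.real Set.univ, ?_⟩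
  filter_upwards [eventually_gt_atTop R, eventually_gt_atTop 0] with r hr hr0
  refine norm_sphereIntegral_le hn hr0 fun x hx => ?_
  have := hR x (by simpa [exterior, hx] using hr)
  rwa [Real.norm_of_nonneg (rpowNeg_nonneg _ _)] at this

namespace FluxEquiv

variable {f g f' g' : Coord n → ℝ}

theorem refl_pderiv {u : Coord n → ℝ} {c : ℝ} (hu : IsAsympConst u c) (i : Fin n) :
    FluxEquiv (pderiv i u) (pderiv i u) :=
  ⟨hu.continuousAt_pderiv i, hu.continuousAt_pderiv i, hu.pderiv_isBigO i, by
    simp⟩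

theorem congr_left (h : FluxEquiv f g) (hf : f =ᶠ[cobounded (Coord n)] f') : FluxEquiv f' g := by
  refine ⟨?_, h.continuousAt_right, h.isBigO, ?_⟩
  · filter_upwards [h.continuousAt_left, eventually_cobounded_eventually_nhds hf] with x h1 h2
    exact h1.congr h2
  · exact h.sub_isLittleO.congr' (hf.mono fun x hx => by simp [hx]) EventuallyEq.rfl

theorem add (h : FluxEquiv f g) (h' : FluxEquiv f' g') :
    FluxEquiv (fun x => f x + f' x) (fun x => g x + g' x) where
  continuousAt_left := by
    filter_upwards [h.continuousAt_left, h'.continuousAt_left] with x h1 h2 using h1.add h2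
  continuousAt_right := by
    filter_upwards [h.continuousAt_right, h'.continuousAt_right] with x h1 h2 using h1.add h2
  isBigO := h.isBigO.add h'.isBigO
  sub_isLittleO := (h.sub_isLittleO.add h'.sub_isLittleO).congr_left fun x => by ring

theorem const_mul (c : ℝ) (h : FluxEquiv f g) :
    FluxEquiv (fun x => c * f x) (fun x => c * g x) where
  continuousAt_left := by
    filter_upwards [h.continuousAt_left] with x h1 using continuousAt_const.mul h1
  continuousAt_right := by
    filter_upwards [h.continuousAt_right] with x h1 using continuousAt_const.mul h1
  isBigO := h.isBigO.const_mul_left c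
  sub_isLittleO := (h.sub_isLittleO.const_mul_left c).congr_left fun x => by ring

theorem neg (h : FluxEquiv f g) : FluxEquiv (fun x => -f x) (fun x => -g x) := by
  simpa using h.const_mul (-1)

theorem sub (h : FluxEquiv f g) (h' : FluxEquiv f' g') :
    FluxEquiv (fun x => f x - f' x) (fun x => g x - g' x) := by
  simpa [sub_eq_add_neg] using h.add h'.neg

theorem sum {ι : Type*} (s : Finset ι) {f g : ι → Coord n → ℝ}
    (h : ∀ i ∈ s, FluxEquiv (f i) (g i)) :
    FluxEquiv (fun x => ∑ i ∈ s, f i x) (fun x => ∑ i ∈ s, g i x) := by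
  classical
  induction s using Finset.induction_on with
  | empty =>
    simp only [Finset.sum_empty]
    exact ⟨Eventually.of_forall fun _ => continuousAt_const,
      Eventually.of_forall fun _ => continuousAt_const, isBigO_zero _ _, by
        simp⟩
  | insert a s ha ih =>
    simp only [Finset.sum_insert ha]
    exact (h a (Finset.mem_insert_self a s)).add
      (ih fun i hi => h i (Finset.mem_insert_of_mem hi))

/-- An asymptotically constant coefficient may be replaced by its limit. -/
theorem asympConst_mul (hn : 2 < n) {B : Coord n → ℝ} {c : ℝ} (hB : IsAsympConst B c)
    (h : FluxEquiv f g) : FluxEquiv (fun x => B x * f x) (fun x => c * g x) where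
  continuousAt_left := by
    filter_upwards [h.continuousAt_left, hB.continuousAt] with x h1 h2 using h2.mul h1
  continuousAt_right := by
    filter_upwards [h.continuousAt_right] with x h1 using continuousAt_const.mul h1
  isBigO := h.isBigO.const_mul_left c
  sub_isLittleO := by
    have hn' : (2 : ℝ) < n := by exact_mod_cast hn
    have h1 := (hB.isBigO_one hn).mul_isLittleO h.sub_isLittleO
    have h2 := (hB.sub_isBigO.trans_isLittleO
      (rpowNeg_isLittleO_one (by linarith : (0 : ℝ) < n - 2))).mul_isBigO h.isBigO
    simp only [one_mul] at h1 h2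
    exact (h1.add h2).congr_left fun x => by ring

theorem mul_bounded {b : Coord n → ℝ} (hb : ∀ᶠ x in cobounded (Coord n), ContinuousAt b x)
    (hb' : b =O[cobounded (Coord n)] fun _ => (1 : ℝ)) (h : FluxEquiv f g) :
    FluxEquiv (fun x => f x * b x) (fun x => g x * b x) where
  continuousAt_left := by
    filter_upwards [h.continuousAt_left, hb] with x h1 h2 using h1.mul h2
  continuousAt_right := by
    filter_upwards [h.continuousAt_right, hb] with x h1 h2 using h1.mul h2
  isBigO := by simpa using h.isBigO.mul hb'
  sub_isLittleO := by
    have := h.sub_isLittleO.mul_isBigO hb'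
    simp only [mul_one] at this
    exact this.congr_left fun x => by ring

theorem tendsto_sphereIntegral (hn : 0 < n) (h : FluxEquiv f g) :
    Tendsto (fun r => sphereIntegral r f - sphereIntegral r g) atTop (𝓝 0) := by
  obtain ⟨R, hR⟩ := eventually_cobounded_iff.1 (h.continuousAt_left.and h.continuousAt_right)
  refine (tendsto_sphereIntegral_of_isLittleO hn h.sub_isLittleO).congr' ?_
  filter_upwards [eventually_gt_atTop (max R 0)] with r hr
  have hsub := exterior_subset (n := n) (le_max_left R 0)
  exact sphereIntegral_sub (le_max_right R 0) hr
    (fun x hx => (hR x (hsub hx)).1.continuousWithinAt)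
    (fun x hx => (hR x (hsub hx)).2.continuousWithinAt)

end FluxEquiv

theorem drCovec_isBigO_one (i : Fin n) :
    (fun x : Coord n => drCovec x i) =O[cobounded (Coord n)] fun _ => (1 : ℝ) := by
  refine IsBigO.of_bound 1 ?_
  filter_upwards [eventually_exterior 0] with x hx
  have hx' : 0 < ‖x‖ := hx
  rw [drCovec, norm_div, norm_norm, norm_one, mul_one]
  exact (div_le_one hx').2 (PiLp.norm_apply_le x i)

theorem continuousAt_drCovec (i : Fin n) :
    ∀ᶠ x in cobounded (Coord n), ContinuousAt (fun x : Coord n => drCovec x i) x := by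
  filter_upwards [eventually_exterior 0] with x hx
  have hx' : ‖x‖ ≠ 0 := ne_of_gt hx
  unfold drCovec
  exact ContinuousAt.div (by fun_prop) (by fun_prop) hx'

/-- In an asymptotically Euclidean metric `|dr|_g ≠ 0` near infinity. -/
theorem drNorm_ne_zero (hn : 2 < n) {G : Coord n → Matrix (Fin n) (Fin n) ℝ}
    (hG : ∀ i j, IsAsympConst (fun x => G x i j) ((1 : Matrix (Fin n) (Fin n) ℝ) i j)) :
    ∀ᶠ x in cobounded (Coord n), drNorm G x ≠ 0 := by
  have h1 : Tendsto (fun x : Coord n => ∑ i, ∑ j, ((G x)⁻¹ i j - (1 : Matrix (Fin n) (Fin n) ℝ) i j)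
      * (drCovec x i * drCovec x j)) (cobounded (Coord n)) (𝓝 0) := by
    rw [← Finset.sum_const_zero (s := (Finset.univ : Finset (Fin n)))]
    refine tendsto_finsetSum _ fun i _ => ?_
    rw [← Finset.sum_const_zero (s := (Finset.univ : Finset (Fin n)))]
    refine tendsto_finsetSum _ fun j _ => ?_
    have h2 : (fun x => (G x)⁻¹ i j - (1 : Matrix (Fin n) (Fin n) ℝ) i j) =o[cobounded (Coord n)]
        fun _ => (1 : ℝ) := by
      refine (isLittleO_one_iff ℝ).2 ?_
      simpa using ((IsAsympConst.inv hn hG i j).tendsto hn).sub_const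
        ((1 : Matrix (Fin n) (Fin n) ℝ) i j)
    have h3 := h2.mul_isBigO ((drCovec_isBigO_one (n := n) i).mul (drCovec_isBigO_one j))
    simp only [mul_one] at h3
    exact (isLittleO_one_iff ℝ).1 h3
  filter_upwards [h1.eventually (lt_mem_nhds (show (-1 : ℝ) < 0 by norm_num)),
    eventually_exterior 0] with x hx hx0
  have hx' : 0 < ‖x‖ := hx0
  have h4 : ∑ i, drCovec x i * drCovec x i = 1 := by
    have h5 := EuclideanSpace.real_norm_sq_eq x
    simp only [drCovec, div_mul_div_comm, ← Finset.sum_div]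
    rw [div_eq_one_iff_eq (by positivity)]
    simp only [← sq]
    exact h5.symm
  have h6 : drCovec x ⬝ᵥ ((G x)⁻¹ *ᵥ drCovec x) = 1 + ∑ i, ∑ j, ((G x)⁻¹ i j
      - (1 : Matrix (Fin n) (Fin n) ℝ) i j) * (drCovec x i * drCovec x j) := by
    simp only [sub_mul, Finset.sum_sub_distrib]
    simp only [Matrix.one_apply, ite_mul, one_mul, zero_mul, Finset.sum_ite_eq, Finset.mem_univ,
      if_true]
    rw [h4, add_sub_cancel]
    simp only [dotProduct, mulVec, Finset.mul_sum]
    refine Finset.sum_congr rfl fun i _ => Finset.sum_congr rfl fun j _ => ?_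
    ring
  rw [drNorm, h6]
  exact (Real.sqrt_pos.2 (by linarith)).ne'

end Flux

/-! ### The linearized mass -/

section Mass

open Asymptotics Bornology

variable {n : ℕ}

/-- The flux density `(∂ⱼg_{ij} - ∂ᵢg_{jj}) xⁱ/r` of the mass, with the Euclidean normal and area
element. -/
noncomputable def massDensity (G : Coord n → Matrix (Fin n) (Fin n) ℝ) (x : Coord n) : ℝ :=
  ∑ i, (∑ j, (pderiv j (fun y => G y i j) x - pderiv i (fun y => G y j j) x)) * drCovec x i

theorem fluxEquiv_massDensity_refl {G : Coord n → Matrix (Fin n) (Fin n) ℝ}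
    (hG : ∀ i j, IsAsympConst (fun x => G x i j) ((1 : Matrix (Fin n) (Fin n) ℝ) i j)) :
    FluxEquiv (massDensity G) (massDensity G) :=
  FluxEquiv.sum _ fun i _ => FluxEquiv.mul_bounded (continuousAt_drCovec i)
    (drCovec_isBigO_one i) (FluxEquiv.sum _ fun j _ =>
      (FluxEquiv.refl_pderiv (hG i j) j).sub (FluxEquiv.refl_pderiv (hG j j) i))

/-- The induced normal and area element may be replaced by the Euclidean ones in the mass. -/
theorem tendsto_massIntegral_sub (hn : 2 < n) {G : Coord n → Matrix (Fin n) (Fin n) ℝ}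
    (hG : ∀ i j, IsAsympConst (fun x => G x i j) ((1 : Matrix (Fin n) (Fin n) ℝ) i j)) :
    Tendsto (fun r => massIntegral G r - 1 / 2 * sphereIntegral r (massDensity G)) atTop
      (𝓝 0) := by
  have h1 := FluxEquiv.asympConst_mul hn (IsAsympConst.sqrt_det hn hG)
    (fluxEquiv_massDensity_refl hG)
  have h2 := (h1.congr_left (f' := fun x =>
    (∑ i, ∑ j, (pderiv j (fun y => G y i j) x - pderiv i (fun y => G y j j) x)
      * unitConormal G x i) * areaDensity G x) ?_).tendsto_sphereIntegral (by omega)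
  · simp only [one_mul] at h2
    have h3 := h2.const_mul (1 / 2)
    rw [mul_zero] at h3
    refine h3.congr fun r => ?_
    rw [mul_sub]
    rfl
  · filter_upwards [drNorm_ne_zero hn hG] with x hx
    simp only [massDensity, unitConormal, areaDensity]
    rw [Finset.mul_sum, Finset.sum_mul]
    refine Finset.sum_congr rfl fun i _ => ?_
    rw [← Finset.sum_mul]
    field_simp

/-- In terms of an orthonormal coframe, the linearized metric is the symmetrized coframe. -/
theorem fluxEquiv_massDensity_coframe (hn : 2 < n) {G A : Coord n → Matrix (Fin n) (Fin n) ℝ}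
    (hA : ∀ i j, IsAsympConst (fun x => A x i j) ((1 : Matrix (Fin n) (Fin n) ℝ) i j))
    (hGA : ∀ᶠ x in cobounded (Coord n), G x = A x * (A x)ᵀ) :
    FluxEquiv (massDensity G) fun x => ∑ i, (∑ j, (pderiv j (fun y => A y i j) x
      + pderiv j (fun y => A y j i) x - 2 * pderiv i (fun y => A y j j) x)) * drCovec x i := by
  have hpd : ∀ k i j, FluxEquiv (pderiv k fun y => G y i j)
      fun x => pderiv k (fun y => A y i j) x + pderiv k (fun y => A y j i) x := by
    intro k i j
    have h1 := FluxEquiv.sum Finset.univ fun h _ =>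
      (FluxEquiv.asympConst_mul hn (hA i h) (FluxEquiv.refl_pderiv (hA j h) k)).add
      (FluxEquiv.asympConst_mul hn (hA j h) (FluxEquiv.refl_pderiv (hA i h) k))
    have e : (fun x => ∑ h, ((1 : Matrix (Fin n) (Fin n) ℝ) i h * pderiv k (fun y => A y j h) x
        + (1 : Matrix (Fin n) (Fin n) ℝ) j h * pderiv k (fun y => A y i h) x)) =
        fun x => pderiv k (fun y => A y i j) x + pderiv k (fun y => A y j i) x := by
      funext x
      simp [Finset.sum_add_distrib, Matrix.one_apply, add_comm]
    rw [e] at h1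
    refine h1.congr_left ?_
    filter_upwards [eventually_cobounded_eventually_nhds hGA,
      eventually_all.2 fun i => eventually_all.2 fun j => (hA i j).differentiableAt] with x hx hd
    have h2 : (fun y => G y i j) =ᶠ[𝓝 x] fun y => ∑ h, A y i h * A y j h := by
      filter_upwards [hx] with y hy
      rw [hy, Matrix.mul_apply]
      rfl
    have h3 : pderiv k (fun y => G y i j) x =
        ∑ h, pderiv k (fun y => A y i h * A y j h) x := by
      rw [pderiv, h2.fderiv_eq]
      exact pderiv_sum _ (f := fun h y => A y i h * A y j h) fun h _ => (hd i h).mul (hd j h)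
    rw [h3]
    refine Finset.sum_congr rfl fun h _ => ?_
    rw [pderiv_mul (hd i h) (hd j h)]
    ring
  have h := FluxEquiv.sum Finset.univ fun i _ => FluxEquiv.mul_bounded (continuousAt_drCovec i)
    (drCovec_isBigO_one i) (FluxEquiv.sum Finset.univ fun j _ => (hpd j i j).sub (hpd i j j))
  simp only [← two_mul] at h
  exact h

end Mass

/-! ### Clifford algebra -/

section Clifford

variable {n : ℕ}

/-- The real part `Re (ψ̃ M ψ)` of the expectation of a matrix `M` in the spinor `ψ`. -/
noncomputable def spinExpect (ψ : SpinVec n) : SpinMatrix n →ₗ[ℝ] ℝ where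
  toFun M := (star ψ ⬝ᵥ (M *ᵥ ψ)).re
  map_add' M N := by simp [Matrix.add_mulVec]
  map_smul' c M := by simp [Matrix.smul_mulVec]

theorem spinExpect_apply (ψ : SpinVec n) (M : SpinMatrix n) :
    spinExpect ψ M = (star ψ ⬝ᵥ (M *ᵥ ψ)).re := rfl

theorem spinExpect_one {ψ : SpinVec n} (hψ : star ψ ⬝ᵥ ψ = 1) : spinExpect ψ 1 = 1 := by
  simp [spinExpect_apply, hψ]

theorem spinExpect_conjTranspose (ψ : SpinVec n) (M : SpinMatrix n) :
    spinExpect ψ Mᴴ = spinExpect ψ M := by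
  rw [spinExpect_apply, spinExpect_apply, ← Complex.conj_re (star ψ ⬝ᵥ (M *ᵥ ψ))]
  congr 1
  change _ = star (star ψ ⬝ᵥ (M *ᵥ ψ))
  rw [Matrix.star_dotProduct, Matrix.star_mulVec, ← Matrix.dotProduct_mulVec]
  simp

variable {γ : Fin n → SpinMatrix n}

theorem IsGamma.clifford_real (hγ : IsGamma γ) (i j : Fin n) :
    γ i * γ j + γ j * γ i = (2 * (1 : Matrix (Fin n) (Fin n) ℝ) i j) • (1 : SpinMatrix n) := by
  rw [hγ.clifford i j]
  by_cases h : i = j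
  · subst h
    ext a b
    simp
  · simp [h]

/-- The bivectors `γ_h γ_k`, `h ≠ k`, are antihermitian and do not contribute to real parts. -/
theorem IsGamma.spinExpect_mul (hγ : IsGamma γ) {ψ : SpinVec n} (hψ : star ψ ⬝ᵥ ψ = 1)
    (h k : Fin n) : spinExpect ψ (γ h * γ k) = (1 : Matrix (Fin n) (Fin n) ℝ) h k := by
  have h1 := congrArg (spinExpect ψ) (hγ.clifford_real h k)
  rw [map_add, map_smul, spinExpect_one hψ, smul_eq_mul, mul_one] at h1
  have h2 : spinExpect ψ (γ k * γ h) = spinExpect ψ (γ h * γ k) := by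
    rw [← spinExpect_conjTranspose, Matrix.conjTranspose_mul, (hγ.hermitian h).eq,
      (hγ.hermitian k).eq]
  linarith

/-- The real part of the expectation of the totally antisymmetric part of `γ_i γ_j γ_h γ_k`. The
part removed from the product is its scalar part; bivectors have purely imaginary expectation. -/
noncomputable def quadExpect (γ : Fin n → SpinMatrix n) (ψ : SpinVec n) (i j h k : Fin n) : ℝ :=
  spinExpect ψ (γ i * γ j * (γ h * γ k))
    - (1 : Matrix (Fin n) (Fin n) ℝ) i j * (1 : Matrix (Fin n) (Fin n) ℝ) h k
    + (1 : Matrix (Fin n) (Fin n) ℝ) i h * (1 : Matrix (Fin n) (Fin n) ℝ) j k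
    - (1 : Matrix (Fin n) (Fin n) ℝ) i k * (1 : Matrix (Fin n) (Fin n) ℝ) j h

theorem one_apply_symm (i j : Fin n) :
    (1 : Matrix (Fin n) (Fin n) ℝ) i j = (1 : Matrix (Fin n) (Fin n) ℝ) j i := by
  simp [Matrix.one_apply, eq_comm]

variable {ψ : SpinVec n}

theorem quadExpect_swap_fst (hγ : IsGamma γ) (hψ : star ψ ⬝ᵥ ψ = 1) (i j h k : Fin n) :
    quadExpect γ ψ j i h k = -quadExpect γ ψ i j h k := by
  have e : γ i * γ j * (γ h * γ k) + γ j * γ i * (γ h * γ k) =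
      (2 * (1 : Matrix (Fin n) (Fin n) ℝ) i j) • (γ h * γ k) := by
    rw [← add_mul, hγ.clifford_real, smul_mul_assoc, one_mul]
  have h1 := congrArg (spinExpect ψ) e
  rw [map_add, map_smul, hγ.spinExpect_mul hψ, smul_eq_mul] at h1
  unfold quadExpect
  rw [one_apply_symm j i]
  linarith

theorem quadExpect_swap_mid (hγ : IsGamma γ) (hψ : star ψ ⬝ᵥ ψ = 1) (i j h k : Fin n) :
    quadExpect γ ψ i h j k = -quadExpect γ ψ i j h k := by
  have e : γ i * γ j * (γ h * γ k) + γ i * γ h * (γ j * γ k) =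
      (2 * (1 : Matrix (Fin n) (Fin n) ℝ) j h) • (γ i * γ k) := by
    have : γ i * γ j * (γ h * γ k) + γ i * γ h * (γ j * γ k) =
      γ i * (γ j * γ h + γ h * γ j) * γ k := by noncomm_ring
    rw [this, hγ.clifford_real, mul_smul_comm, smul_mul_assoc, mul_one]
  have h1 := congrArg (spinExpect ψ) e
  rw [map_add, map_smul, hγ.spinExpect_mul hψ, smul_eq_mul] at h1
  unfold quadExpect
  rw [one_apply_symm h j]
  linarith

theorem quadExpect_swap_last (hγ : IsGamma γ) (hψ : star ψ ⬝ᵥ ψ = 1) (i j h k : Fin n) :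
    quadExpect γ ψ i j k h = -quadExpect γ ψ i j h k := by
  have e : γ i * γ j * (γ h * γ k) + γ i * γ j * (γ k * γ h) =
      (2 * (1 : Matrix (Fin n) (Fin n) ℝ) h k) • (γ i * γ j) := by
    rw [← mul_add, hγ.clifford_real, mul_smul_comm, mul_one]
  have h1 := congrArg (spinExpect ψ) e
  rw [map_add, map_smul, hγ.spinExpect_mul hψ, smul_eq_mul] at h1
  unfold quadExpect
  rw [one_apply_symm k h]
  linarith

/-- Frame components of `𝒰` as a linear function of the connection coefficients. -/
theorem spinVector_eq_sum (hγ : IsGamma γ) (hψ : star ψ ⬝ᵥ ψ = 1)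
    {A : Coord n → Matrix (Fin n) (Fin n) ℝ} {φ : Coord n → SpinVec n} {x : Coord n}
    (hφ : φ x = ψ) (i : Fin n) :
    spinVector γ A φ i x = ∑ j, ∑ h, ∑ k, (1 / 4 * (-quadExpect γ ψ i j h k
      + (1 : Matrix (Fin n) (Fin n) ℝ) i h * (1 : Matrix (Fin n) (Fin n) ℝ) j k
      - (1 : Matrix (Fin n) (Fin n) ℝ) i k * (1 : Matrix (Fin n) (Fin n) ℝ) j h))
        * connCoeff A j h k x := by
  have e : ∀ j, ((1 : Matrix (Fin n) (Fin n) ℂ) i j • (1 : SpinMatrix n) - γ i * γ j)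
      * spinConn γ A j x = ∑ h, ∑ k, (1 / 4 * connCoeff A j h k x) •
        ((1 : Matrix (Fin n) (Fin n) ℝ) i j • (γ h * γ k) - γ i * γ j * (γ h * γ k)) := by
    intro j
    have h1 : (1 : Matrix (Fin n) (Fin n) ℂ) i j • (1 : SpinMatrix n) =
        (1 : Matrix (Fin n) (Fin n) ℝ) i j • (1 : SpinMatrix n) := by
      by_cases h : i = j
      · subst h; simp
      · simp [h]
    have h2 : spinConn γ A j x = ∑ h, ∑ k, (1 / 4 * connCoeff A j h k x) • (γ h * γ k) := by
      unfold spinConn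
      simp only [Finset.smul_sum, smul_smul]
      refine Finset.sum_congr rfl fun h _ => Finset.sum_congr rfl fun k _ => ?_
      ext a b
      simp
    rw [h1, h2, Finset.mul_sum]
    refine Finset.sum_congr rfl fun h _ => ?_
    rw [Finset.mul_sum]
    refine Finset.sum_congr rfl fun k _ => ?_
    rw [mul_smul_comm, sub_mul, smul_mul_assoc, one_mul]
  have h0 : spinVector γ A φ i x = spinExpect ψ (∑ j,
      ((1 : Matrix (Fin n) (Fin n) ℂ) i j • (1 : SpinMatrix n) - γ i * γ j)
      * spinConn γ A j x) := by
    rw [spinVector, hφ, spinExpect_apply]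
  rw [h0]
  simp only [e, map_sum, map_smul, map_sub, hγ.spinExpect_mul hψ, smul_eq_mul]
  refine Finset.sum_congr rfl fun j _ => Finset.sum_congr rfl fun h _ =>
    Finset.sum_congr rfl fun k _ => ?_
  unfold quadExpect
  ring

/-- The contraction of a totally antisymmetric tensor with the connection of a coframe with
derivatives `D`. -/
theorem sum_antisymm_mul_conn {σ D : Fin n → Fin n → Fin n → ℝ}
    (h₁ : ∀ j h k, σ h j k = -σ j h k) (h₂ : ∀ j h k, σ j k h = -σ j h k) :
    ∑ j, ∑ h, ∑ k, σ j h k * (1 / 2 * (-(D h k j - D k h j) + (D j h k - D h j k)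
      - (D j k h - D k j h))) = ∑ j, ∑ h, ∑ k, σ j h k * D j h k := by
  have s1 : ∀ D : Fin n → Fin n → Fin n → ℝ,
      ∑ j, ∑ h, ∑ k, σ j h k * D h j k = -∑ j, ∑ h, ∑ k, σ j h k * D j h k := by
    intro D
    rw [Finset.sum_comm, ← Finset.sum_neg_distrib]
    refine Finset.sum_congr rfl fun j _ => ?_
    rw [← Finset.sum_neg_distrib]
    refine Finset.sum_congr rfl fun h _ => ?_
    rw [← Finset.sum_neg_distrib]
    exact Finset.sum_congr rfl fun k _ => by rw [h₁]; ring
  have s2 : ∀ D : Fin n → Fin n → Fin n → ℝ,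
      ∑ j, ∑ h, ∑ k, σ j h k * D j k h = -∑ j, ∑ h, ∑ k, σ j h k * D j h k := by
    intro D
    rw [← Finset.sum_neg_distrib]
    refine Finset.sum_congr rfl fun j _ => ?_
    rw [Finset.sum_comm, ← Finset.sum_neg_distrib]
    refine Finset.sum_congr rfl fun h _ => ?_
    rw [← Finset.sum_neg_distrib]
    exact Finset.sum_congr rfl fun k _ => by rw [h₂]; ring
  have a1 := s1 D
  have a2 := s2 D
  have a3 := s1 fun a b c => D a c b
  have a4 := s2 fun a b c => D b a c
  have a5 := s2 fun a b c => D b c a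
  have e : ∀ j h k, σ j h k * (1 / 2 * (-(D h k j - D k h j) + (D j h k - D h j k)
      - (D j k h - D k j h))) = 1 / 2 * (-(σ j h k * D h k j) + σ j h k * D k h j
        + σ j h k * D j h k - σ j h k * D h j k - σ j h k * D j k h + σ j h k * D k j h) := by
    intro j h k; ring
  simp only [e, ← Finset.mul_sum, Finset.sum_add_distrib, Finset.sum_sub_distrib,
    Finset.sum_neg_distrib]
  linarith

end Clifford

/-! ### The flux of the spin vector -/

section SpinFlux

open Asymptotics Bornology

variable {n : ℕ} {A : Coord n → Matrix (Fin n) (Fin n) ℝ}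

theorem fluxEquiv_rotCoeff (hn : 2 < n)
    (hA : ∀ i j, IsAsympConst (fun x => A x i j) ((1 : Matrix (Fin n) (Fin n) ℝ) i j))
    (h i j : Fin n) :
    FluxEquiv (rotCoeff A h i j)
      fun x => pderiv i (fun y => A y j h) x - pderiv j (fun y => A y i h) x := by
  have h1 := FluxEquiv.sum Finset.univ fun k _ => FluxEquiv.sum Finset.univ fun l _ =>
    FluxEquiv.asympConst_mul hn
      (((IsAsympConst.inv hn hA i k).mul hn (IsAsympConst.inv hn hA j l)))
      ((FluxEquiv.refl_pderiv (hA l h) k).sub (FluxEquiv.refl_pderiv (hA k h) l))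
  have e : (fun x => ∑ k, ∑ l, (1 : Matrix (Fin n) (Fin n) ℝ) i k
      * (1 : Matrix (Fin n) (Fin n) ℝ) j l *
      (pderiv k (fun y => A y l h) x - pderiv l (fun y => A y k h) x)) =
      fun x => pderiv i (fun y => A y j h) x - pderiv j (fun y => A y i h) x := by
    funext x
    simp [Matrix.one_apply]
  rw [e] at h1
  exact h1

theorem fluxEquiv_connCoeff (hn : 2 < n)
    (hA : ∀ i j, IsAsympConst (fun x => A x i j) ((1 : Matrix (Fin n) (Fin n) ℝ) i j))
    (j h k : Fin n) :
    FluxEquiv (connCoeff A j h k) fun x => 1 / 2 *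
      (-(pderiv h (fun y => A y k j) x - pderiv k (fun y => A y h j) x)
        + (pderiv j (fun y => A y h k) x - pderiv h (fun y => A y j k) x)
        - (pderiv j (fun y => A y k h) x - pderiv k (fun y => A y j h) x)) :=
  (((fluxEquiv_rotCoeff hn hA j h k).neg.add (fluxEquiv_rotCoeff hn hA k j h)).sub
    (fluxEquiv_rotCoeff hn hA h j k)).const_mul _

/-- The connection coefficients of a coframe at the identity with derivatives `D`. -/
noncomputable def linConn (D : Fin n → Fin n → Fin n → ℝ) (j h k : Fin n) : ℝ :=
  1 / 2 * (-(D h k j - D k h j) + (D j h k - D h j k) - (D j k h - D k j h))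

/-- Algebraic form of the theorem at the linear level: the spin vector differs from half the mass
density by the divergence of an antisymmetric matrix. -/
theorem sum_quadExpect_mul_linConn {γ : Fin n → SpinMatrix n} (hγ : IsGamma γ) {ψ : SpinVec n}
    (hψ : star ψ ⬝ᵥ ψ = 1) (D : Fin n → Fin n → Fin n → ℝ) (i : Fin n) :
    ∑ j, ∑ h, ∑ k, (1 / 4 * (-quadExpect γ ψ i j h k
      + (1 : Matrix (Fin n) (Fin n) ℝ) i h * (1 : Matrix (Fin n) (Fin n) ℝ) j k
      - (1 : Matrix (Fin n) (Fin n) ℝ) i k * (1 : Matrix (Fin n) (Fin n) ℝ) j h))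
        * linConn D j h k =
    1 / 4 * ∑ j, (D j i j + D j j i - 2 * D i j j)
      + ∑ j, (1 / 4 * (D j i j - D j j i) - 1 / 4 * ∑ h, ∑ k, quadExpect γ ψ i j h k * D j h k) := by
  have h1 := sum_antisymm_mul_conn (σ := fun j h k => quadExpect γ ψ i j h k) (D := D)
    (fun j h k => quadExpect_swap_mid hγ hψ i j h k)
    (fun j h k => quadExpect_swap_last hγ hψ i j h k)
  have e : ∀ j h k, (1 / 4 * (-quadExpect γ ψ i j h k
      + (1 : Matrix (Fin n) (Fin n) ℝ) i h * (1 : Matrix (Fin n) (Fin n) ℝ) j k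
      - (1 : Matrix (Fin n) (Fin n) ℝ) i k * (1 : Matrix (Fin n) (Fin n) ℝ) j h))
        * linConn D j h k = -(1 / 4) * (quadExpect γ ψ i j h k * linConn D j h k)
        + 1 / 4 * ((1 : Matrix (Fin n) (Fin n) ℝ) i h * ((1 : Matrix (Fin n) (Fin n) ℝ) j k
          * linConn D j h k))
        - 1 / 4 * ((1 : Matrix (Fin n) (Fin n) ℝ) j h * ((1 : Matrix (Fin n) (Fin n) ℝ) i k
          * linConn D j h k)) := by
    intro j h k; ring
  simp only [e, Finset.sum_add_distrib, Finset.sum_sub_distrib, ← Finset.mul_sum]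
  have h2 : ∑ j, ∑ h, ∑ k, quadExpect γ ψ i j h k * linConn D j h k =
      ∑ j, ∑ h, ∑ k, quadExpect γ ψ i j h k * D j h k := h1
  have h3 : ∑ j, ∑ h, (1 : Matrix (Fin n) (Fin n) ℝ) i h * ∑ k,
      (1 : Matrix (Fin n) (Fin n) ℝ) j k * linConn D j h k = ∑ j, linConn D j i j := by
    simp [Matrix.one_apply]
  have h4 : ∑ j, ∑ h, (1 : Matrix (Fin n) (Fin n) ℝ) j h * ∑ k,
      (1 : Matrix (Fin n) (Fin n) ℝ) i k * linConn D j h k = ∑ j, linConn D j j i := by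
    simp [Matrix.one_apply]
  have h5 : ∑ j, linConn D j i j = ∑ j, D j i j - ∑ j, D i j j := by
    rw [← Finset.sum_sub_distrib]
    refine Finset.sum_congr rfl fun j _ => ?_
    unfold linConn; ring
  have h6 : ∑ j, linConn D j j i = ∑ j, D i j j - ∑ j, D j i j := by
    rw [← Finset.sum_sub_distrib]
    refine Finset.sum_congr rfl fun j _ => ?_
    unfold linConn; ring
  rw [h2, h3, h4, h5, h6]
  ring

/-- The spin flux and half the mass integral have the same limit behaviour at infinity. -/
theorem tendsto_spinIntegral_sub_massIntegral (hn : 2 < n)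
    {G : Coord n → Matrix (Fin n) (Fin n) ℝ}
    (hG : ∀ i j, IsAsympConst (fun x => G x i j) ((1 : Matrix (Fin n) (Fin n) ℝ) i j))
    (hA : ∀ i j, IsAsympConst (fun x => A x i j) ((1 : Matrix (Fin n) (Fin n) ℝ) i j))
    (hGA : ∀ᶠ x in cobounded (Coord n), G x = A x * (A x)ᵀ)
    {γ : Fin n → SpinMatrix n} (hγ : IsGamma γ) {ψ : SpinVec n} (hψ : star ψ ⬝ᵥ ψ = 1)
    {φ : Coord n → SpinVec n} (hφ : ∀ᶠ x in cobounded (Coord n), φ x = ψ) :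
    Tendsto (fun r => spinIntegral γ G A φ r - 1 / 2 * massIntegral G r) atTop (𝓝 0) := by
  let D : Coord n → Fin n → Fin n → Fin n → ℝ := fun x k l h => pderiv k (fun y => A y l h) x
  let T : Fin n → Fin n → Fin n → Fin n → ℝ := fun i j h k =>
    1 / 4 * (-quadExpect γ ψ i j h k
      + (1 : Matrix (Fin n) (Fin n) ℝ) i h * (1 : Matrix (Fin n) (Fin n) ℝ) j k
      - (1 : Matrix (Fin n) (Fin n) ℝ) i k * (1 : Matrix (Fin n) (Fin n) ℝ) j h)
  let L : Coord n → ℝ := fun x =>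
    ∑ i, (∑ j, ∑ h, ∑ k, T i j h k * linConn (D x) j h k) * drCovec x i
  let Mx : Coord n → ℝ := fun x =>
    ∑ i, (∑ j, (D x j i j + D x j j i - 2 * D x i j j)) * drCovec x i
  have hU : ∀ i, FluxEquiv (spinVector γ A φ i)
      fun x => ∑ j, ∑ h, ∑ k, T i j h k * linConn (D x) j h k := by
    intro i
    have h1 := FluxEquiv.sum Finset.univ fun j _ => FluxEquiv.sum Finset.univ fun h _ =>
      FluxEquiv.sum Finset.univ fun k _ => (fluxEquiv_connCoeff hn hA j h k).const_mul (T i j h k)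
    refine h1.congr_left ?_
    filter_upwards [hφ] with x hx
    exact (spinVector_eq_sum hγ hψ hx i).symm
  -- passage to the Euclidean normal, area element and frame, and linearization
  have hspin : Tendsto (fun r => spinIntegral γ G A φ r - sphereIntegral r L) atTop (𝓝 0) := by
    have h1 := FluxEquiv.sum Finset.univ fun i _ => FluxEquiv.sum Finset.univ fun k _ =>
      FluxEquiv.asympConst_mul hn
        ((IsAsympConst.sqrt_det hn hG).mul hn (IsAsympConst.inv hn hA i k))
        ((hU i).mul_bounded (continuousAt_drCovec k) (drCovec_isBigO_one k))
    have e : (fun x => ∑ i, ∑ k, (1 * (1 : Matrix (Fin n) (Fin n) ℝ) i k) *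
        ((∑ j, ∑ h, ∑ k, T i j h k * linConn (D x) j h k) * drCovec x k)) = L := by
      funext x
      simp [L, Matrix.one_apply]
    rw [e] at h1
    refine (h1.congr_left ?_).tendsto_sphereIntegral (by omega)
    filter_upwards [drNorm_ne_zero hn hG] with x hx
    simp only [frame, mulVec, dotProduct, unitConormal, areaDensity]
    rw [Finset.sum_mul]
    refine Finset.sum_congr rfl fun i _ => ?_
    rw [Finset.mul_sum, Finset.sum_mul]
    refine Finset.sum_congr rfl fun k _ => ?_
    field_simp
  have hmass := (fluxEquiv_massDensity_coframe hn hA hGA).tendsto_sphereIntegral (by omega)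
  have hmass' := tendsto_massIntegral_sub hn hG
  let F : Fin n → Fin n → Coord n → ℝ := fun i j x =>
    1 / 4 * (A x i j - A x j i) - 1 / 4 * ∑ h, ∑ k, quadExpect γ ψ i j h k * A x h k
  have hFanti : ∀ i j x, F j i x = -F i j x := by
    intro i j x
    simp only [F, quadExpect_swap_fst hγ hψ i j, neg_mul, Finset.sum_neg_distrib]
    ring
  obtain ⟨R, hR⟩ := eventually_cobounded_iff.1
    (eventually_all.2 fun i => eventually_all.2 fun j => (hA i j).contDiffAt)
  have hd : ∀ i j, ∀ x ∈ exterior n R, DifferentiableAt ℝ (fun y => A y i j) x :=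
    fun i j x hx => (hR x hx i j).differentiableAt one_ne_zero
  have hF : ∀ i j, ContDiffOn ℝ 1 (F i j) (exterior n R) := by
    intro i j x hx
    refine ContDiffAt.contDiffWithinAt ?_
    exact (contDiffAt_const.mul ((hR x hx i j).sub (hR x hx j i))).sub
      (contDiffAt_const.mul (ContDiffAt.sum fun h _ => ContDiffAt.sum fun k _ =>
        contDiffAt_const.mul (hR x hx h k)))
  have hFd : ∀ i j, ∀ x ∈ exterior n R, pderiv j (F i j) x =
      1 / 4 * (D x j i j - D x j j i)
        - 1 / 4 * ∑ h, ∑ k, quadExpect γ ψ i j h k * D x j h k := by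
    intro i j x hx
    have hcm : ∀ (c : ℝ) (u : Coord n → ℝ), DifferentiableAt ℝ u x →
        pderiv j (fun y => c * u y) x = c * pderiv j u x := by
      intro c u hu
      rw [pderiv, fderiv_const_mul hu]
      rfl
    have hsub : ∀ u v : Coord n → ℝ, DifferentiableAt ℝ u x → DifferentiableAt ℝ v x →
        pderiv j (fun y => u y - v y) x = pderiv j u x - pderiv j v x := by
      intro u v hu hv
      rw [pderiv, fderiv_fun_sub hu hv]
      rfl
    have d1 := (hd i j x hx).fun_sub (hd j i x hx)
    have d2 : ∀ h k, DifferentiableAt ℝ (fun y => quadExpect γ ψ i j h k * A y h k) x :=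
      fun h k => (hd h k x hx).const_mul _
    have d3 : ∀ h, DifferentiableAt ℝ (fun y => ∑ k, quadExpect γ ψ i j h k * A y h k) x :=
      fun h => DifferentiableAt.fun_sum fun k _ => d2 h k
    have d4 : DifferentiableAt ℝ (fun y => ∑ h, ∑ k, quadExpect γ ψ i j h k * A y h k) x :=
      DifferentiableAt.fun_sum fun h _ => d3 h
    simp only [F]
    rw [hsub _ _ (d1.const_mul _) (d4.const_mul _), hcm _ _ d1, hcm _ _ d4,
      hsub _ _ (hd i j x hx) (hd j i x hx), pderiv_sum _ fun h _ => d3 h]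
    congr 2
    refine Finset.sum_congr rfl fun h _ => ?_
    rw [pderiv_sum _ fun k _ => d2 h k]
    exact Finset.sum_congr rfl fun k _ => hcm _ _ (hd h k x hx)
  have hcont : ∀ k l h, ContinuousOn (fun x => D x k l h) (exterior n (max R 0)) := by
    intro k l h x hx
    exact (((hR x (exterior_subset (le_max_left R 0) hx) l h).continuousAt_fderiv
      one_ne_zero).clm_apply continuousAt_const).continuousWithinAt
  have hcontdr : ∀ i, ContinuousOn (fun x : Coord n => drCovec x i) (exterior n (max R 0)) := by
    intro i x hx
    have hx' : ‖x‖ ≠ 0 := ne_of_gt ((le_max_right R 0).trans_lt hx)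
    unfold drCovec
    exact (ContinuousAt.div (by fun_prop) (by fun_prop) hx').continuousWithinAt
  have hLM : ∀ᶠ r in atTop, sphereIntegral r L - 1 / 4 * sphereIntegral r Mx = 0 := by
    filter_upwards [eventually_gt_atTop (max R 0)] with r hr
    have hLc : ContinuousOn L (exterior n (max R 0)) :=
      continuousOn_finsetSum _ fun i _ => (continuousOn_finsetSum _ fun j _ =>
        continuousOn_finsetSum _ fun h _ => continuousOn_finsetSum _ fun k _ =>
          continuousOn_const.mul (continuousOn_const.mul (((((hcont _ _ _).sub (hcont _ _ _)).neg.add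
            ((hcont _ _ _).sub (hcont _ _ _)))).sub ((hcont _ _ _).sub (hcont _ _ _))))).mul
              (hcontdr i)
    have hMc : ContinuousOn Mx (exterior n (max R 0)) :=
      continuousOn_finsetSum _ fun i _ => (continuousOn_finsetSum _ fun j _ =>
        ((hcont _ _ _).add (hcont _ _ _)).sub (continuousOn_const.mul (hcont _ _ _))).mul
          (hcontdr i)
    have hMc' : ContinuousOn (fun x => 1 / 4 * Mx x) (exterior n (max R 0)) :=
      continuousOn_const.mul hMc
    rw [← sphereIntegral_const_mul, ← sphereIntegral_sub (le_max_right R 0) hr hLc hMc']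
    have hr0 : 0 < r := (le_max_right R 0).trans_lt hr
    rw [← sphereIntegral_curl_eq_zero (by omega) (le_max_right R 0)
      (fun i j => (hF i j).mono (exterior_subset (le_max_left R 0))) hFanti hr]
    refine sphereIntegral_congr hr0.le fun x hx => ?_
    have hxR : x ∈ exterior n R := by
      simpa [exterior, hx] using (le_max_left R 0).trans_lt hr
    simp only [L, Mx, Finset.mul_sum]
    rw [← Finset.sum_sub_distrib]
    refine Finset.sum_congr rfl fun i _ => ?_
    rw [← Finset.sum_mul]
    have := sum_quadExpect_mul_linConn hγ hψ (D x) i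
    simp only [T]
    rw [this, Finset.sum_congr rfl fun j _ => hFd i j x hxR]
    simp only [drCovec]
    ring
  have := (hspin.sub (hmass.const_mul (1 / 4))).sub (hmass'.const_mul (1 / 2))
  simp only [mul_zero, sub_zero] at this
  refine this.congr' ?_
  filter_upwards [hLM] with r hr
  have hr' : sphereIntegral r (fun x => ∑ i, (∑ j, (pderiv j (fun y => A y i j) x
      + pderiv j (fun y => A y j i) x - 2 * pderiv i (fun y => A y j j) x)) * drCovec x i) =
      sphereIntegral r Mx := rfl
  rw [hr']
  linarith

end SpinFlux

/-! ### Weak divergences and convergence of fluxes -/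

section WeakDivergence

open Asymptotics Bornology

variable {n : ℕ} {R : ℝ}

/-- `f = div V + Q` weakly on the exterior domain, tested against radial functions, for a vector
field `V` with radial component `X`. -/
structure HasRadialDiv (R : ℝ) (f X Q : Coord n → ℝ) : Prop where
  continuousOn_radial : ContinuousOn X (exterior n R)
  continuousOn_rest : ContinuousOn Q (exterior n R)
  integrable : ∀ χ : ℝ → ℝ, ContDiff ℝ 1 χ → HasCompactSupport χ → tsupport χ ⊆ Set.Ioi R →
    Integrable fun x : Coord n => χ ‖x‖ * f x
  integral_eq : ∀ χ : ℝ → ℝ, ContDiff ℝ 1 χ → HasCompactSupport χ → tsupport χ ⊆ Set.Ioi R →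
    ∫ x : Coord n, χ ‖x‖ * f x =
      -(∫ x : Coord n, deriv χ ‖x‖ * X x) + ∫ x : Coord n, χ ‖x‖ * Q x

theorem tsupport_deriv_subset_tsupport (χ : ℝ → ℝ) : tsupport (deriv χ) ⊆ tsupport χ :=
  closure_minimal (support_deriv_subset) (isClosed_tsupport _)

theorem integrable_radial_mul (hR : 0 ≤ R) {X : Coord n → ℝ} (hX : ContinuousOn X (exterior n R))
    {χ : ℝ → ℝ} (hχ : ContDiff ℝ 1 χ) (hc : HasCompactSupport χ) (hs : tsupport χ ⊆ Set.Ioi R) :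
    Integrable fun x : Coord n => χ ‖x‖ * X x := by
  obtain ⟨h1, h2, h3, -⟩ := radial_testFunction (n := n) hR hχ hc hs
  simpa only [mul_comm] using hX.integrable_mul_of_tsupport_subset (μ := volume)
    (isOpen_exterior n R).measurableSet h1.continuous h2 h3

theorem integrable_deriv_radial_mul (hR : 0 ≤ R) {X : Coord n → ℝ}
    (hX : ContinuousOn X (exterior n R)) {χ : ℝ → ℝ} (hχ : ContDiff ℝ 1 χ)
    (hc : HasCompactSupport χ) (hs : tsupport χ ⊆ Set.Ioi R) :
    Integrable fun x : Coord n => deriv χ ‖x‖ * X x := by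
  obtain ⟨h1, h2, h3, -⟩ := radial_testFunction (n := n) hR hχ hc hs
  have hsub : tsupport (fun x : Coord n => deriv χ ‖x‖) ⊆
      (fun x : Coord n => ‖x‖) ⁻¹' tsupport χ :=
    (tsupport_comp_subset_preimage (deriv χ) continuous_norm).trans
      (Set.preimage_mono (tsupport_deriv_subset_tsupport χ))
  have hcs : HasCompactSupport fun x : Coord n => deriv χ ‖x‖ := by
    obtain ⟨B, hB⟩ := hc.isBounded.exists_norm_le
    refine (isCompact_closedBall (0 : Coord n) B).of_isClosed_subset (isClosed_tsupport _) ?_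
    intro x hx
    simpa using hB _ (hsub hx)
  simpa only [mul_comm] using hX.integrable_mul_of_tsupport_subset (μ := volume)
    (isOpen_exterior n R).measurableSet
    (φ := fun x : Coord n => deriv χ ‖x‖)
    ((hχ.continuous_deriv le_rfl).comp continuous_norm) hcs (hsub.trans fun x hx => hs hx)

namespace HasRadialDiv

variable {f X Q f' X' Q' : Coord n → ℝ}

theorem of_continuousOn (hR : 0 ≤ R) (hf : ContinuousOn f (exterior n R)) :
    HasRadialDiv R f (fun _ => 0) f where
  continuousOn_radial := continuousOn_const
  continuousOn_rest := hf
  integrable _ hχ hc hs := integrable_radial_mul hR hf hχ hc hs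
  integral_eq χ _ _ _ := by simp

theorem add (hR : 0 ≤ R) (h : HasRadialDiv R f X Q) (h' : HasRadialDiv R f' X' Q') :
    HasRadialDiv R (fun x => f x + f' x) (fun x => X x + X' x) (fun x => Q x + Q' x) where
  continuousOn_radial := h.continuousOn_radial.add h'.continuousOn_radial
  continuousOn_rest := h.continuousOn_rest.add h'.continuousOn_rest
  integrable χ hχ hc hs := by
    simpa only [mul_add] using (h.integrable χ hχ hc hs).fun_add (h'.integrable χ hχ hc hs)
  integral_eq χ hχ hc hs := by
    simp only [mul_add]
    rw [integral_add (h.integrable χ hχ hc hs) (h'.integrable χ hχ hc hs),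
      integral_add (integrable_radial_mul hR h.continuousOn_rest hχ hc hs)
        (integrable_radial_mul hR h'.continuousOn_rest hχ hc hs),
      integral_add (integrable_deriv_radial_mul hR h.continuousOn_radial hχ hc hs)
        (integrable_deriv_radial_mul hR h'.continuousOn_radial hχ hc hs),
      h.integral_eq χ hχ hc hs, h'.integral_eq χ hχ hc hs]
    ring

theorem const_mul (c : ℝ) (h : HasRadialDiv R f X Q) :
    HasRadialDiv R (fun x => c * f x) (fun x => c * X x) (fun x => c * Q x) where
  continuousOn_radial := continuousOn_const.mul h.continuousOn_radial
  continuousOn_rest := continuousOn_const.mul h.continuousOn_rest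
  integrable χ hχ hc hs := by
    simpa only [mul_left_comm _ c] using (h.integrable χ hχ hc hs).const_mul c
  integral_eq χ hχ hc hs := by
    simp only [mul_left_comm _ c, integral_const_mul]
    rw [h.integral_eq χ hχ hc hs]
    ring

theorem sub (hR : 0 ≤ R) (h : HasRadialDiv R f X Q) (h' : HasRadialDiv R f' X' Q') :
    HasRadialDiv R (fun x => f x - f' x) (fun x => X x - X' x) (fun x => Q x - Q' x) := by
  simpa [sub_eq_add_neg] using h.add hR (h'.const_mul (-1))

theorem sum (hR : 0 ≤ R) {ι : Type*} (s : Finset ι) {f X Q : ι → Coord n → ℝ}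
    (h : ∀ i ∈ s, HasRadialDiv R (f i) (X i) (Q i)) :
    HasRadialDiv R (fun x => ∑ i ∈ s, f i x) (fun x => ∑ i ∈ s, X i x)
      (fun x => ∑ i ∈ s, Q i x) := by
  classical
  induction s using Finset.induction_on with
  | empty =>
    simpa using of_continuousOn hR (f := fun _ : Coord n => 0) continuousOn_const
  | insert a s ha ih =>
    simp only [Finset.sum_insert ha]
    exact (h a (Finset.mem_insert_self a s)).add hR
      (ih fun i hi => h i (Finset.mem_insert_of_mem hi))

/-- The product rule for a weak second derivative with a `C¹` coefficient. -/
theorem of_isWeakDeriv (hR : 0 ≤ R) {U : Set (Coord n)} (hU : exterior n R ⊆ U) {p q : Fin n}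
    {u v B : Coord n → ℝ} (h : IsWeakDeriv U ![p, q] u v)
    (hu : ContDiffOn ℝ 1 u (exterior n R)) (hB : ContDiffOn ℝ 1 B (exterior n R)) :
    HasRadialDiv R (fun x => B x * v x) (fun x => B x * (pderiv p u x * drCovec x q))
      (fun x => -(pderiv q B x * pderiv p u x)) := by
  have hUo := isOpen_exterior n R
  have hdr : ContinuousOn (fun x : Coord n => drCovec x q) (exterior n R) := by
    intro x hx
    have hx' : ‖x‖ ≠ 0 := ne_of_gt (hR.trans_lt hx)
    unfold drCovec
    exact (ContinuousAt.div (by fun_prop) (by fun_prop) hx').continuousWithinAt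
  have hX : ContinuousOn (fun x => B x * (pderiv p u x * drCovec x q)) (exterior n R) :=
    hB.continuousOn.mul ((hu.continuousOn_pderiv hUo p).mul hdr)
  have hQ : ContinuousOn (fun x => -(pderiv q B x * pderiv p u x)) (exterior n R) :=
    ((hB.continuousOn_pderiv hUo q).mul (hu.continuousOn_pderiv hUo p)).neg
  have hprod : ∀ χ : ℝ → ℝ, ContDiff ℝ 1 χ → HasCompactSupport χ → tsupport χ ⊆ Set.Ioi R →
      ContDiff ℝ 1 (fun x => B x * χ ‖x‖) ∧ HasCompactSupport (fun x => B x * χ ‖x‖) ∧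
      tsupport (fun x => B x * χ ‖x‖) ⊆ exterior n R := by
    intro χ hχ hc hs
    obtain ⟨h1, h2, h3, -⟩ := radial_testFunction (n := n) hR hχ hc hs
    have hsub : tsupport (fun x : Coord n => B x * χ ‖x‖) ⊆ tsupport fun x : Coord n => χ ‖x‖ :=
      tsupport_mul_subset_right
    refine ⟨contDiff_iff_contDiffAt.2 fun x => ?_,
      h2.of_isClosed_subset (isClosed_tsupport _) hsub, hsub.trans h3⟩
    by_cases hx : x ∈ tsupport fun x : Coord n => χ ‖x‖
    · exact (hB.contDiffAt (hUo.mem_nhds (h3 hx))).mul h1.contDiffAt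
    · refine contDiffAt_const (c := (0 : ℝ)) |>.congr_of_eventuallyEq ?_
      exact notMem_tsupport_iff_eventuallyEq.1 fun h => hx (hsub h)
  refine ⟨hX, hQ, fun χ hχ hc hs => ?_, fun χ hχ hc hs => ?_⟩
  · obtain ⟨h1, h2, h3⟩ := hprod χ hχ hc hs
    have := h.2.1.integrable_mul_of_tsupport_subset h1.continuous h2 (h3.trans hU)
    refine this.congr (Eventually.of_forall fun x => ?_)
    simp only
    ring
  · obtain ⟨h1, h2, h3⟩ := hprod χ hχ hc hs
    obtain ⟨k1, -, k3, k4⟩ := radial_testFunction (n := n) hR hχ hc hs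
    have hw := h.integral_mul_eq_neg_integral_pderiv hUo hU hu h1 h2 h3
    have e1 : ∀ x, χ ‖x‖ * (B x * v x) = v x * (B x * χ ‖x‖) := fun x => by ring
    have e2 : ∀ x, pderiv p u x * pderiv q (fun y => B y * χ ‖y‖) x =
        deriv χ ‖x‖ * (B x * (pderiv p u x * drCovec x q))
          - χ ‖x‖ * -(pderiv q B x * pderiv p u x) := by
      intro x
      by_cases hx : x ∈ exterior n R
      · rw [pderiv_mul ((hB.contDiffAt (hUo.mem_nhds hx)).differentiableAt one_ne_zero)
          (k1.differentiable one_ne_zero x), k4, drCovec]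
        ring
      · have z1 : χ ‖x‖ = 0 := by
          by_contra hne
          exact hx (hs (subset_tsupport _ hne))
        have z2 : deriv χ ‖x‖ = 0 := by
          by_contra hne
          exact hx (hs (tsupport_deriv_subset_tsupport χ (subset_tsupport _ hne)))
        have z3 : pderiv q (fun y => B y * χ ‖y‖) x = 0 := by
          by_contra hne
          exact hx (h3 (tsupport_fderiv_apply_subset_tsupport _ (coordVec q)
            (subset_tsupport _ hne)))
        rw [z1, z2, z3]
        ring
    simp only [e1]
    rw [hw]
    simp only [e2]
    rw [integral_sub (integrable_deriv_radial_mul hR hX hχ hc hs)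
      (integrable_radial_mul hR hQ hχ hc hs)]
    ring

/-- If the divergence is bounded below by an integrable power of the radius, up to an error of the
same size, then the flux is monotone up to a term that tends to zero, so a bounded flux
converges. -/
theorem exists_tendsto_sphereIntegral (hn : 2 < n) (hR : 0 ≤ R) (h : HasRadialDiv R f X Q)
    {C : ℝ} (hX : X =O[cobounded (Coord n)] rpowNeg n ((n : ℝ) - 1))
    (hf : ∀ᵐ x ∂(volume : Measure (Coord n)).restrict (exterior n R),
      -(C * rpowNeg n (2 * ((n : ℝ) - 1)) x) ≤ f x - Q x) :
    ∃ l, Tendsto (fun r => sphereIntegral r X) atTop (𝓝 l) := by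
  have hn2 : (0 : ℝ) < (n : ℝ) - 2 := by
    have : (2 : ℝ) < n := by exact_mod_cast hn
    linarith
  let a := (volume : Measure (Coord n)).toSphere.real Set.univ
  -- `κ' = C a r^{1-n}` is the integral over `S_r` of the lower bound `C r^{2-2n}`
  let κ : ℝ → ℝ := fun r => -(a * C / ((n : ℝ) - 2)) * r ^ (-((n : ℝ) - 2))
  have hκd : ∀ r : ℝ, 0 < r → HasDerivAt κ (C * (a * r ^ (-((n : ℝ) - 1)))) r := by
    intro r hr
    have h1 := (Real.hasDerivAt_rpow_const (x := r) (p := -((n : ℝ) - 2))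
      (Or.inl hr.ne')).const_mul (-(a * C / ((n : ℝ) - 2)))
    have e : -((n : ℝ) - 2) - 1 = -((n : ℝ) - 1) := by ring
    rw [e] at h1
    refine h1.congr_deriv ?_
    field_simp
  have hw : ContinuousOn (rpowNeg n (2 * ((n : ℝ) - 1))) (exterior n R) := by
    intro x hx
    have hx' : ‖x‖ ≠ 0 := ne_of_gt (hR.trans_lt hx)
    exact ((continuousAt_id.norm).rpow_const (Or.inl hx')).continuousWithinAt
  have hwI : ∀ r : ℝ, 0 < r → sphereIntegral r (rpowNeg n (2 * ((n : ℝ) - 1))) =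
      a * r ^ (-((n : ℝ) - 1)) := by
    intro r hr
    rw [sphereIntegral_congr (F' := fun _ => r ^ (-(2 * ((n : ℝ) - 1)))) hr.le
      fun x hx => by rw [rpowNeg, hx]]
    have e : ((n - 1 : ℕ) : ℝ) = (n : ℝ) - 1 := by
      rw [Nat.cast_sub (by omega), Nat.cast_one]
    rw [sphereIntegral, integral_const, smul_eq_mul, ← Real.rpow_natCast, e, mul_left_comm,
      ← Real.rpow_add hr]
    congr 2
    ring
  have hΦc := continuousOn_sphereIntegral hR h.continuousOn_radial
  have hκc : ContDiffOn ℝ 1 κ (Set.Ioi R) := by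
    intro r hr
    have hr' : r ≠ 0 := ne_of_gt (hR.trans_lt hr)
    exact (contDiffAt_const.mul (Real.contDiffAt_rpow_const (Or.inl hr'))).contDiffWithinAt
  have hmono : MonotoneOn (fun r => sphereIntegral r X + κ r) (Set.Ioi R) := by
    refine monotoneOn_Ioi_of_integral_deriv_mul_nonpos (hΦc.add hκc.continuousOn) ?_
    intro χ hχ hc hs hχ0
    have hint := h.integrable χ hχ hc hs
    have hintQ := integrable_radial_mul hR h.continuousOn_rest hχ hc hs
    have hintw := integrable_radial_mul hR hw hχ hc hs
    have h1 : -(C * ∫ x : Coord n, χ ‖x‖ * rpowNeg n (2 * ((n : ℝ) - 1)) x) ≤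
        ∫ x : Coord n, (χ ‖x‖ * f x - χ ‖x‖ * Q x) := by
      rw [← integral_const_mul, ← integral_neg]
      refine integral_mono_ae (hintw.const_mul C).neg (hint.sub hintQ) ?_
      have := (ae_restrict_iff' (isOpen_exterior n R).measurableSet).1 hf
      filter_upwards [this] with x hx
      by_cases hxR : x ∈ exterior n R
      · have := mul_le_mul_of_nonneg_left (hx hxR) (hχ0 ‖x‖)
        linarith
      · have z1 : χ ‖x‖ = 0 := by
          by_contra hne
          exact hxR (hs (subset_tsupport _ hne))
        simp [z1]
    rw [integral_sub hint hintQ, h.integral_eq χ hχ hc hs, neg_add_eq_sub, sub_sub,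
      integral_mul_radial (by omega) hR hintw hs,
      integral_mul_radial (by omega) hR
        (integrable_deriv_radial_mul hR h.continuousOn_radial hχ hc hs)
        ((tsupport_deriv_subset_tsupport χ).trans hs)] at h1
    have h2 : ∫ r, κ r * deriv χ r =
        -(C * ∫ r, χ r * sphereIntegral r (rpowNeg n (2 * ((n : ℝ) - 1)))) := by
      have := integral_mul_fderiv_eq_neg_of_tsupport_subset (μ := volume) isOpen_Ioi hκc hχ hc hs 1
      simp only [fderiv_eq_smul_deriv, one_smul] at this
      rw [this, ← integral_const_mul]
      congr 1
      refine integral_congr_ae (Eventually.of_forall fun r => ?_)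
      by_cases hr : r ∈ Set.Ioi R
      · have hr0 : 0 < r := hR.trans_lt hr
        simp only
        rw [(hκd r hr0).deriv, hwI r hr0]
        ring
      · have z1 : χ r = 0 := by
          by_contra hne
          exact hr (hs (subset_tsupport _ hne))
        simp [z1]
    have hderc : Continuous (deriv χ) := hχ.continuous_deriv le_rfl
    have hdcs : HasCompactSupport (deriv χ) := hc.deriv
    have hds := (tsupport_deriv_subset_tsupport χ).trans hs
    have i1 := hΦc.integrable_mul_of_tsupport_subset (μ := volume) measurableSet_Ioi hderc hdcs hds
    have i2 := hκc.continuousOn.integrable_mul_of_tsupport_subset (μ := volume) measurableSet_Ioi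
      hderc hdcs hds
    have h3 : ∫ r, deriv χ r * (sphereIntegral r X + κ r) =
        (∫ r, deriv χ r * sphereIntegral r X) + ∫ r, κ r * deriv χ r := by
      have := integral_add i1 i2
      simp only [mul_comm _ (deriv χ _), mul_add] at this ⊢
      exact this
    rw [h3, h2]
    linarith
  have hκ0 : Tendsto κ atTop (𝓝 0) := by
    have := (tendsto_rpow_neg_atTop hn2).const_mul (-(a * C / ((n : ℝ) - 2)))
    rwa [mul_zero] at this
  obtain ⟨B, hB⟩ := exists_norm_sphereIntegral_le (by omega) hX
  have hmono' : Monotone fun r => sphereIntegral (max r (R + 1)) X + κ (max r (R + 1)) := by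
    intro r r' hrr
    have hlt : ∀ t, R < max t (R + 1) := fun t => (lt_add_one R).trans_le (le_max_right _ _)
    exact hmono (hlt r) (hlt r') (max_le_max_right _ hrr)
  have hev : (fun r => sphereIntegral (max r (R + 1)) X + κ (max r (R + 1))) =ᶠ[atTop]
      fun r => sphereIntegral r X + κ r := by
    filter_upwards [eventually_ge_atTop (R + 1)] with r hr
    rw [max_eq_left hr]
  rcases tendsto_atTop_of_monotone hmono' with htop | ⟨l, hl⟩
  · exfalso
    have h1 := htop.congr' hev
    have h2 := hκ0.eventually (gt_mem_nhds (show (0 : ℝ) < 1 by norm_num))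
    obtain ⟨r, hr1, hr2, hr3⟩ := ((h1.eventually_gt_atTop (B + 1)).and (hB.and h2)).exists
    have := (abs_le.1 hr2).2
    linarith
  · refine ⟨l, ?_⟩
    have h1 := (hl.congr' hev).sub hκ0
    simpa using h1

end HasRadialDiv

end WeakDivergence

/-! ### Scalar curvature and existence of the mass -/

section Constraint

open Asymptotics Bornology

variable {n : ℕ} {G K : Coord n → Matrix (Fin n) (Fin n) ℝ}

/-- The coefficient `√g g^{ac} g^{bd}` of the second derivatives in `√g R`. -/
noncomputable def curvCoeff (G : Coord n → Matrix (Fin n) (Fin n) ℝ) (a b c d : Fin n)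
    (x : Coord n) : ℝ :=
  √(G x).det * ((G x)⁻¹ a c * (G x)⁻¹ b d)

theorem isAsympConst_curvCoeff (hn : 2 < n)
    (hG : ∀ i j, IsAsympConst (fun x => G x i j) ((1 : Matrix (Fin n) (Fin n) ℝ) i j))
    (a b c d : Fin n) :
    IsAsympConst (curvCoeff G a b c d)
      (1 * ((1 : Matrix (Fin n) (Fin n) ℝ) a c * (1 : Matrix (Fin n) (Fin n) ℝ) b d)) :=
  (IsAsympConst.sqrt_det hn hG).mul hn
    ((IsAsympConst.inv hn hG a c).mul hn (IsAsympConst.inv hn hG b d))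

/-- The radial component of the vector field whose divergence is `√g R` up to terms quadratic in
the first derivatives of the metric. -/
noncomputable def curvFlux (G : Coord n → Matrix (Fin n) (Fin n) ℝ) (x : Coord n) : ℝ :=
  ∑ a, ∑ b, ∑ c, ∑ d, 1 / 2 *
    (curvCoeff G a b c d x * (pderiv b (fun y => G y a d) x * drCovec x c)
      + curvCoeff G a b c d x * (pderiv a (fun y => G y b c) x * drCovec x d)
      - curvCoeff G a b c d x * (pderiv a (fun y => G y b d) x * drCovec x c)
      - curvCoeff G a b c d x * (pderiv b (fun y => G y a c) x * drCovec x d))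

/-- The part of `√g R` that is quadratic in the Christoffel symbols. -/
noncomputable def christoffelPart (G : Coord n → Matrix (Fin n) (Fin n) ℝ) (a b c d : Fin n)
    (x : Coord n) : ℝ :=
  curvCoeff G a b c d x * ∑ e, ∑ f, G x e f * (christoffel G e b c x * christoffel G f a d x
      - christoffel G e b d x * christoffel G f a c x)

/-- The terms of `√g R - div V` that are quadratic in the first derivatives of the metric, `V` being
the vector field with radial component `curvFlux G`. -/
noncomputable def curvRest (G : Coord n → Matrix (Fin n) (Fin n) ℝ) (x : Coord n) : ℝ :=
  ∑ a, ∑ b, ∑ c, ∑ d, (1 / 2 *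
    (-(pderiv c (curvCoeff G a b c d) x * pderiv b (fun y => G y a d) x)
      + -(pderiv d (curvCoeff G a b c d) x * pderiv a (fun y => G y b c) x)
      - -(pderiv c (curvCoeff G a b c d) x * pderiv a (fun y => G y b d) x)
      - -(pderiv d (curvCoeff G a b c d) x * pderiv b (fun y => G y a c) x))
      + christoffelPart G a b c d x)

theorem rpowNeg_mul_self_isBigO (n : ℕ) :
    (fun x => rpowNeg n ((n : ℝ) - 1) x * rpowNeg n ((n : ℝ) - 1) x) =O[cobounded (Coord n)]
      rpowNeg n (2 * ((n : ℝ) - 1)) := by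
  refine (rpowNeg_mul_eventuallyEq _ _).trans_isBigO ?_
  rw [← two_mul]

theorem christoffel_isBigO (hn : 2 < n)
    (hG : ∀ i j, IsAsympConst (fun x => G x i j) ((1 : Matrix (Fin n) (Fin n) ℝ) i j))
    (e b c : Fin n) :
    christoffel G e b c =O[cobounded (Coord n)] rpowNeg n ((n : ℝ) - 1) := by
  refine IsBigO.const_mul_left (IsBigO.fun_sum fun m _ => ?_) _
  have := ((IsAsympConst.inv hn hG e m).isBigO_one hn).mul
    (((hG m c).pderiv_isBigO b).add ((hG m b).pderiv_isBigO c) |>.sub ((hG b c).pderiv_isBigO m))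
  simpa only [one_mul] using this

theorem christoffelPart_isBigO (hn : 2 < n)
    (hG : ∀ i j, IsAsympConst (fun x => G x i j) ((1 : Matrix (Fin n) (Fin n) ℝ) i j))
    (a b c d : Fin n) :
    christoffelPart G a b c d =O[cobounded (Coord n)] rpowNeg n (2 * ((n : ℝ) - 1)) := by
  have h1 : ∀ e f b c a d, (fun x => christoffel G e b c x * christoffel G f a d x)
      =O[cobounded (Coord n)] rpowNeg n (2 * ((n : ℝ) - 1)) := fun e f b c a d =>
    ((christoffel_isBigO hn hG e b c).mul (christoffel_isBigO hn hG f a d)).trans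
      (rpowNeg_mul_self_isBigO n)
  have h2 : (fun x => ∑ e, ∑ f, G x e f * (christoffel G e b c x * christoffel G f a d x
      - christoffel G e b d x * christoffel G f a c x)) =O[cobounded (Coord n)]
      rpowNeg n (2 * ((n : ℝ) - 1)) := by
    refine IsBigO.fun_sum fun e _ => IsBigO.fun_sum fun f _ => ?_
    simpa only [one_mul] using ((hG e f).isBigO_one hn).mul ((h1 e f b c a d).sub (h1 e f b d a c))
  have h3 := ((isAsympConst_curvCoeff hn hG a b c d).isBigO_one hn).mul h2
  simp only [one_mul] at h3
  exact h3

theorem curvRest_isBigO (hn : 2 < n)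
    (hG : ∀ i j, IsAsympConst (fun x => G x i j) ((1 : Matrix (Fin n) (Fin n) ℝ) i j)) :
    curvRest G =O[cobounded (Coord n)] rpowNeg n (2 * ((n : ℝ) - 1)) := by
  refine IsBigO.fun_sum fun a _ => IsBigO.fun_sum fun b _ => IsBigO.fun_sum fun c _ =>
    IsBigO.fun_sum fun d _ => IsBigO.add (IsBigO.const_mul_left ?_ _)
      (christoffelPart_isBigO hn hG a b c d)
  have h : ∀ q p r s, (fun x => -(pderiv q (curvCoeff G a b c d) x * pderiv p (fun y => G y r s) x))
      =O[cobounded (Coord n)] rpowNeg n (2 * ((n : ℝ) - 1)) := fun q p r s =>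
    ((((isAsympConst_curvCoeff hn hG a b c d).pderiv_isBigO q).mul
      ((hG r s).pderiv_isBigO p)).trans (rpowNeg_mul_self_isBigO n)).neg_left
  exact (((h c b a d).add (h d a b c)).sub (h c a b d)).sub (h d b a c)

/-- At infinity the flux of the curvature is the flux of the mass. -/
theorem fluxEquiv_curvFlux (hn : 2 < n)
    (hG : ∀ i j, IsAsympConst (fun x => G x i j) ((1 : Matrix (Fin n) (Fin n) ℝ) i j)) :
    FluxEquiv (curvFlux G) fun x => ∑ a, ∑ b, 1 / 2 *
      (pderiv b (fun y => G y a b) x * drCovec x a + pderiv a (fun y => G y b a) x * drCovec x b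
        - pderiv a (fun y => G y b b) x * drCovec x a
        - pderiv b (fun y => G y a a) x * drCovec x b) := by
  have h1 : ∀ a b c d p r s q, FluxEquiv
      (fun x => curvCoeff G a b c d x * (pderiv p (fun y => G y r s) x * drCovec x q))
      (fun x => 1 * ((1 : Matrix (Fin n) (Fin n) ℝ) a c * (1 : Matrix (Fin n) (Fin n) ℝ) b d)
        * (pderiv p (fun y => G y r s) x * drCovec x q)) := fun a b c d p r s q =>
    FluxEquiv.asympConst_mul hn (isAsympConst_curvCoeff hn hG a b c d)
      ((FluxEquiv.refl_pderiv (hG r s) p).mul_bounded (continuousAt_drCovec q)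
        (drCovec_isBigO_one q))
  have h2 := FluxEquiv.sum Finset.univ fun a _ => FluxEquiv.sum Finset.univ fun b _ =>
    FluxEquiv.sum Finset.univ fun c _ => FluxEquiv.sum Finset.univ fun d _ =>
      ((((h1 a b c d b a d c).add (h1 a b c d a b c d)).sub (h1 a b c d a b d c)).sub
        (h1 a b c d b a c d)).const_mul (1 / 2)
  have e : (fun x => ∑ a, ∑ b, ∑ c, ∑ d, 1 / 2 *
      (1 * ((1 : Matrix (Fin n) (Fin n) ℝ) a c * (1 : Matrix (Fin n) (Fin n) ℝ) b d)
        * (pderiv b (fun y => G y a d) x * drCovec x c)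
      + 1 * ((1 : Matrix (Fin n) (Fin n) ℝ) a c * (1 : Matrix (Fin n) (Fin n) ℝ) b d)
        * (pderiv a (fun y => G y b c) x * drCovec x d)
      - 1 * ((1 : Matrix (Fin n) (Fin n) ℝ) a c * (1 : Matrix (Fin n) (Fin n) ℝ) b d)
        * (pderiv a (fun y => G y b d) x * drCovec x c)
      - 1 * ((1 : Matrix (Fin n) (Fin n) ℝ) a c * (1 : Matrix (Fin n) (Fin n) ℝ) b d)
        * (pderiv b (fun y => G y a c) x * drCovec x d))) = fun x => ∑ a, ∑ b, 1 / 2 *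
      (pderiv b (fun y => G y a b) x * drCovec x a + pderiv a (fun y => G y b a) x * drCovec x b
        - pderiv a (fun y => G y b b) x * drCovec x a
        - pderiv b (fun y => G y a a) x * drCovec x b) := by
    funext x
    refine Finset.sum_congr rfl fun a _ => Finset.sum_congr rfl fun b _ => ?_
    rw [Finset.sum_eq_single a, Finset.sum_eq_single b]
    · simp
    · intro d _ hd; simp [hd.symm]
    · simp
    · intro c _ hc; simp [Matrix.one_apply, hc.symm]
    · simp
  rw [e] at h2
  exact h2

theorem sum_half_eq_massDensity (G : Coord n → Matrix (Fin n) (Fin n) ℝ) (x : Coord n) :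
    ∑ a, ∑ b, 1 / 2 *
      (pderiv b (fun y => G y a b) x * drCovec x a + pderiv a (fun y => G y b a) x * drCovec x b
        - pderiv a (fun y => G y b b) x * drCovec x a
        - pderiv b (fun y => G y a a) x * drCovec x b) = massDensity G x := by
  have h1 : ∑ a, ∑ b, pderiv a (fun y => G y b a) x * drCovec x b =
      ∑ a, ∑ b, pderiv b (fun y => G y a b) x * drCovec x a := Finset.sum_comm
  have h2 : ∑ a, ∑ b, pderiv b (fun y => G y a a) x * drCovec x b =
      ∑ a, ∑ b, pderiv a (fun y => G y b b) x * drCovec x a := Finset.sum_comm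
  simp only [← Finset.mul_sum, Finset.sum_add_distrib, Finset.sum_sub_distrib, h1, h2,
    massDensity, sub_mul, Finset.sum_mul]
  ring

/-- The product `√g R` is a weak divergence up to quadratic terms. -/
theorem hasRadialDiv_scalarCurv {R : ℝ} (hR : 0 ≤ R) {U : Set (Coord n)} (hU : exterior n R ⊆ U)
    (hG : ∀ i j, ContDiffOn ℝ 1 (fun x => G x i j) (exterior n R))
    (hinv : ∀ i j, ContinuousOn (fun x => (G x)⁻¹ i j) (exterior n R))
    (hP : ∀ a b c d, ContDiffOn ℝ 1 (curvCoeff G a b c d) (exterior n R))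
    {D2 : Fin n → Fin n → Fin n → Fin n → Coord n → ℝ}
    (hD : ∀ a b c d, IsWeakDeriv U ![a, b] (fun y => G y c d) (D2 a b c d)) :
    HasRadialDiv R (fun x => √(G x).det * scalarCurv G D2 x) (curvFlux G) (curvRest G) := by
  have hUo := isOpen_exterior n R
  have hchr : ∀ e b c, ContinuousOn (christoffel G e b c) (exterior n R) := fun e b c =>
    continuousOn_const.mul (continuousOn_finsetSum _ fun m _ => (hinv e m).mul
      ((((hG m c).continuousOn_pderiv hUo b).add ((hG m b).continuousOn_pderiv hUo c)).sub
        ((hG b c).continuousOn_pderiv hUo m)))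
  have hq : ∀ a b c d, ContinuousOn (christoffelPart G a b c d) (exterior n R) := fun a b c d =>
    (hP a b c d).continuousOn.mul (continuousOn_finsetSum _ fun e _ =>
      continuousOn_finsetSum _ fun f _ => (hG e f).continuousOn.mul
        (((hchr e b c).mul (hchr f a d)).sub ((hchr e b d).mul (hchr f a c))))
  have hw : ∀ a b c d p q r s, HasRadialDiv R (fun x => curvCoeff G a b c d x * D2 p q r s x)
      (fun x => curvCoeff G a b c d x * (pderiv p (fun y => G y r s) x * drCovec x q))
      (fun x => -(pderiv q (curvCoeff G a b c d) x * pderiv p (fun y => G y r s) x)) :=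
    fun a b c d p q r s => HasRadialDiv.of_isWeakDeriv hR hU (hD p q r s) (hG r s) (hP a b c d)
  have h := HasRadialDiv.sum hR Finset.univ fun a _ => HasRadialDiv.sum hR Finset.univ fun b _ =>
    HasRadialDiv.sum hR Finset.univ fun c _ => HasRadialDiv.sum hR Finset.univ fun d _ =>
      ((((((hw a b c d b c a d).add hR (hw a b c d a d b c)).sub hR (hw a b c d a c b d)).sub hR
        (hw a b c d b d a c)).const_mul (1 / 2)).add hR
          (HasRadialDiv.of_continuousOn hR (hq a b c d)))
  have e1 : (fun x => √(G x).det * scalarCurv G D2 x) = fun x => ∑ a, ∑ b, ∑ c, ∑ d,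
      (1 / 2 * (curvCoeff G a b c d x * D2 b c a d x + curvCoeff G a b c d x * D2 a d b c x
        - curvCoeff G a b c d x * D2 a c b d x - curvCoeff G a b c d x * D2 b d a c x)
        + christoffelPart G a b c d x) := by
    funext x
    simp only [scalarCurv, Finset.mul_sum]
    refine Finset.sum_congr rfl fun a _ => Finset.sum_congr rfl fun b _ =>
      Finset.sum_congr rfl fun c _ => Finset.sum_congr rfl fun d _ => ?_
    simp only [riemannComp, christoffelPart, curvCoeff]
    ring
  rw [e1]
  simp only [add_zero] at h
  exact h

theorem trace_isBigO (hn : 2 < n)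
    (hG : ∀ i j, IsAsympConst (fun x => G x i j) ((1 : Matrix (Fin n) (Fin n) ℝ) i j))
    (hK : ∀ i j, (fun x => K x i j) =O[cobounded (Coord n)] rpowNeg n ((n : ℝ) - 1)) :
    (fun x => √(G x).det * (((G x)⁻¹ * K x * (G x)⁻¹ * (K x)ᵀ).trace
      - ((G x)⁻¹ * K x).trace ^ 2)) =O[cobounded (Coord n)] rpowNeg n (2 * ((n : ℝ) - 1)) := by
  have hi : ∀ i j, (fun x => (G x)⁻¹ i j) =O[cobounded (Coord n)] fun _ => (1 : ℝ) :=
    fun i j => (IsAsympConst.inv hn hG i j).isBigO_one hn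
  have h1 : ∀ i j, (fun x => ((G x)⁻¹ * K x) i j) =O[cobounded (Coord n)]
      rpowNeg n ((n : ℝ) - 1) := by
    intro i j
    simp only [Matrix.mul_apply]
    exact IsBigO.fun_sum fun k _ => by simpa only [one_mul] using (hi i k).mul (hK k j)
  have h2 : ∀ i j, (fun x => ((G x)⁻¹ * K x * (G x)⁻¹) i j) =O[cobounded (Coord n)]
      rpowNeg n ((n : ℝ) - 1) := by
    intro i j
    simp only [Matrix.mul_apply (M := _ * _)]
    exact IsBigO.fun_sum fun k _ => by simpa only [mul_one] using (h1 i k).mul (hi k j)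
  have h3 : (fun x => ((G x)⁻¹ * K x * (G x)⁻¹ * (K x)ᵀ).trace) =O[cobounded (Coord n)]
      rpowNeg n (2 * ((n : ℝ) - 1)) := by
    simp only [Matrix.trace, Matrix.diag, Matrix.mul_apply (M := _ * _ * _)]
    exact IsBigO.fun_sum fun i _ => IsBigO.fun_sum fun j _ =>
      ((h2 i j).mul (hK i j)).trans (rpowNeg_mul_self_isBigO n)
  have h4 : (fun x => ((G x)⁻¹ * K x).trace) =O[cobounded (Coord n)] rpowNeg n ((n : ℝ) - 1) := by
    simp only [Matrix.trace, Matrix.diag]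
    exact IsBigO.fun_sum fun i _ => h1 i i
  have h5 := (h4.mul h4).trans (rpowNeg_mul_self_isBigO n)
  simp only [← sq] at h5
  simpa only [one_mul] using ((IsAsympConst.sqrt_det hn hG).isBigO_one hn).mul (h3.sub h5)

/-- Under the Hamiltonian constraint with nonnegative energy density the mass exists. -/
theorem HamiltonianConstraint.exists_isMass (hn : 2 < n) {R₀ : ℝ}
    (hG : ∀ i j, IsAsympConst (fun x => G x i j) ((1 : Matrix (Fin n) (Fin n) ℝ) i j))
    (hK : ∀ i j, (fun x => K x i j) =O[cobounded (Coord n)] rpowNeg n ((n : ℝ) - 1))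
    (hH : HamiltonianConstraint (exterior n R₀) G K) : ∃ m, IsMass G m := by
  obtain ⟨D2, T00, hD, hae⟩ := hH
  obtain ⟨C₁, hC₁⟩ := (curvRest_isBigO hn hG).bound
  obtain ⟨C₂, hC₂⟩ := (trace_isBigO hn hG hK).bound
  obtain ⟨R₁, hR₁⟩ := eventually_cobounded_iff.1 ((hC₁.and hC₂).and
    ((eventually_all.2 fun i => eventually_all.2 fun j => (hG i j).contDiffAt).and
    ((eventually_all.2 fun i => eventually_all.2 fun j =>
      (IsAsympConst.inv hn hG i j).continuousAt).and
    (eventually_all.2 fun a => eventually_all.2 fun b => eventually_all.2 fun c =>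
      eventually_all.2 fun d => (isAsympConst_curvCoeff hn hG a b c d).contDiffAt))))
  let R := max (max R₀ R₁) 0
  have hR : 0 ≤ R := le_max_right _ _
  have hR₀ : exterior n R ⊆ exterior n R₀ :=
    exterior_subset ((le_max_left _ _).trans (le_max_left _ _))
  have hR₁' : exterior n R ⊆ exterior n R₁ :=
    exterior_subset ((le_max_right _ _).trans (le_max_left _ _))
  have hdiv := hasRadialDiv_scalarCurv hR hR₀
    (fun i j x hx => ((hR₁ x (hR₁' hx)).2.1 i j).contDiffWithinAt)
    (fun i j x hx => ((hR₁ x (hR₁' hx)).2.2.1 i j).continuousWithinAt)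
    (fun a b c d x hx => ((hR₁ x (hR₁' hx)).2.2.2 a b c d).contDiffWithinAt) hD
  have hflux := fluxEquiv_curvFlux hn hG
  simp only [sum_half_eq_massDensity] at hflux
  have hX : curvFlux G =O[cobounded (Coord n)] rpowNeg n ((n : ℝ) - 1) := by
    have := hflux.sub_isLittleO.isBigO.add hflux.isBigO
    simpa using this
  obtain ⟨l, hl⟩ := hdiv.exists_tendsto_sphereIntegral hn hR (C := C₁ + C₂) hX (by
    filter_upwards [ae_restrict_of_ae_restrict_of_subset hR₀ hae,
      ae_restrict_mem (isOpen_exterior n R).measurableSet] with x hx hxR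
    obtain ⟨hT, hcon⟩ := hx
    obtain ⟨⟨b1, b2⟩, -⟩ := hR₁ x (hR₁' hxR)
    rw [Real.norm_of_nonneg (rpowNeg_nonneg _ _)] at b1 b2
    have b1' := (abs_le.1 b1).2
    have b2' := (abs_le.1 b2).1
    have hs : scalarCurv G D2 x = 2 * T00 x + (((G x)⁻¹ * K x * (G x)⁻¹ * (K x)ᵀ).trace
      - ((G x)⁻¹ * K x).trace ^ 2) := by linarith
    have hpos : 0 ≤ √(G x).det * (2 * T00 x) := by positivity
    rw [hs, mul_add]
    linarith)
  refine ⟨1 / 2 * l, ?_⟩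
  have h1 := tendsto_massIntegral_sub hn hG
  have h2 := hflux.tendsto_sphereIntegral (by omega)
  have h3 := (h1.add (hl.const_mul (1 / 2))).sub (h2.const_mul (1 / 2))
  simp only [zero_add, mul_zero, sub_zero] at h3
  refine h3.congr fun r => ?_
  ring

end Constraint

/-! ### Asymptotically Euclidean ends -/

section Ends

open Asymptotics Bornology

variable {n : ℕ} {M : Type*} [TopologicalSpace M] [ChartedSpace (Coord n) M]

theorem endCutoff_eventuallyEq (P : Preparation n M) (I : Fin P.N) (u : Coord n → ℝ) :
    endCutoff P I u =ᶠ[cobounded (Coord n)] u := by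
  filter_upwards [eventually_exterior P.r₀, eventually_exterior (2 * P.r₀)] with x hx hx2
  have hxt : x ∈ (P.endChart I).target := by rwa [P.endChart_target I]
  have h := P.fEnd_eq_one I _ ((P.endChart I).map_target hxt)
    (by rw [(P.endChart I).right_inv hxt]; exact hx2)
  rw [endCutoff, h, one_mul]

variable [IsManifold (𝓡 n) ∞ M]

theorem IsAsymptoticallyEuclidean.isAsympConst {P : Preparation n M} {g : RMetric n M} {s : ℕ}
    {δ : ℝ} (hg : IsAsymptoticallyEuclidean P g s δ) (I : Fin P.N) (i j : Fin n) :
    IsAsympConst (fun x => metricComp g (P.endChart I) x i j)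
      ((1 : Matrix (Fin n) (Fin n) ℝ) i j) :=
  (hg.end_mem I i j).2.isAsympConst (endCutoff_eventuallyEq P I _)

theorem IsAECoframe.isAsympConst (hn : 2 < n) {P : Preparation n M} {g : RMetric n M} {s : ℕ}
    {δ : ℝ} {I : Fin P.N} {A : Coord n → Matrix (Fin n) (Fin n) ℝ}
    (hA : IsAECoframe P g s δ I A) (i j : Fin n) :
    IsAsympConst (fun x => A x i j) ((1 : Matrix (Fin n) (Fin n) ℝ) i j) := by
  have h : IsAsympConst (fun x => 2 * A x i j) (2 * (1 : Matrix (Fin n) (Fin n) ℝ) i j) :=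
    (hA.asymptotics i j).2.isAsympConst ((endCutoff_eventuallyEq P I _).trans
      (Eventually.of_forall fun x => mul_sub _ _ _))
  simpa using h.const_mul hn (1 / 2)

theorem MemCkβ.isBigO {R β : ℝ} {u f : Coord n → ℝ} (hu : MemCkβ (exterior n R) 0 β u)
    (h : u =ᶠ[cobounded (Coord n)] f) : f =O[cobounded (Coord n)] rpowNeg n β := by
  obtain ⟨-, C, hC⟩ := hu
  refine IsBigO.of_bound C ?_
  filter_upwards [eventually_exterior R, eventually_exterior 0, h] with x hx hx0 hxf
  have hx0' : 0 < ‖x‖ := hx0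
  have := hC 0 le_rfl x hx
  rw [norm_iteratedFDeriv_zero, Nat.cast_zero, add_zero, hxf] at this
  rwa [Real.norm_of_nonneg (rpowNeg_nonneg _ _), rpowNeg, Real.rpow_neg hx0'.le,
    ← div_eq_mul_inv, le_div_iff₀ (by positivity), mul_comm]

end Ends

theorem theorem2 {n : ℕ} (hn : 2 < n) {M : Type*} [TopologicalSpace M] [T2Space M]
    [ChartedSpace (Coord n) M] [IsManifold (𝓡 n) ∞ M]
    (P : Preparation n M) (g : RMetric n M) (s : ℕ) (δ : ℝ)
    (hg : IsAsymptoticallyEuclidean P g s δ) (I : Fin P.N)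
    (A : Coord n → Matrix (Fin n) (Fin n) ℝ) (hA : IsAECoframe P g s δ I A)
    (γ : Fin n → SpinMatrix n) (hγ : IsGamma γ)
    (ψ₀ : Coord n → SpinVec n)
    (hconst : ∀ x ∈ exterior n P.r₀, ∀ y ∈ exterior n P.r₀, ψ₀ x = ψ₀ y)
    (hnorm : ∀ x ∈ exterior n P.r₀, star (ψ₀ x) ⬝ᵥ ψ₀ x = 1) :
    (∀ m : ℝ, IsMass (metricComp g (P.endChart I)) m ↔
      Tendsto (spinIntegral γ (metricComp g (P.endChart I)) A ψ₀) atTop (𝓝 (m / 2))) ∧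
    (∀ K : Coord n → Matrix (Fin n) (Fin n) ℝ,
      (∀ x ∈ exterior n P.r₀, (K x).IsSymm) →
      (∀ i j, MemCkβ (exterior n P.r₀) 0 ((n : ℝ) - 1) (endCutoff P I fun x => K x i j)) →
      HamiltonianConstraint (exterior n (2 * P.r₀)) (metricComp g (P.endChart I)) K →
      ∃ m : ℝ, IsMass (metricComp g (P.endChart I)) m ∧
        Tendsto (spinIntegral γ (metricComp g (P.endChart I)) A ψ₀) atTop (𝓝 (m / 2))) := by
  have : Nonempty (Fin n) := ⟨⟨0, by omega⟩⟩
  have hG := hg.isAsympConst I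
  have hAc := hA.isAsympConst hn
  have hGA : ∀ᶠ x in Bornology.cobounded (Coord n),
      metricComp g (P.endChart I) x = A x * (A x)ᵀ := by
    filter_upwards [eventually_exterior P.r₀] with x hx using hA.orthonormal x hx
  obtain ⟨x₀, hx₀⟩ := (eventually_exterior (n := n) P.r₀).exists
  have hψ : ∀ᶠ x in Bornology.cobounded (Coord n), ψ₀ x = ψ₀ x₀ := by
    filter_upwards [eventually_exterior P.r₀] with x hx using hconst x hx x₀ hx₀
  have hlim := tendsto_spinIntegral_sub_massIntegral hn hG hAc hGA hγ (hnorm x₀ hx₀) hψ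
  have hiff : ∀ m : ℝ, IsMass (metricComp g (P.endChart I)) m ↔
      Tendsto (spinIntegral γ (metricComp g (P.endChart I)) A ψ₀) atTop (𝓝 (m / 2)) := by
    refine fun m => ⟨fun h => ?_, fun h => ?_⟩
    · have h1 := hlim.add (h.const_mul (1 / 2))
      rw [zero_add, one_div_mul_eq_div] at h1
      exact h1.congr fun r => by ring
    · have h1 := (h.sub hlim).const_mul 2
      rw [sub_zero, mul_div_cancel₀ m two_ne_zero] at h1
      exact h1.congr fun r => by ring
  refine ⟨hiff, fun K _ hK hH => ?_⟩
  obtain ⟨m, hm⟩ := hH.exists_isMass hn hG fun i j =>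
    (hK i j).isBigO (endCutoff_eventuallyEq P I _)
  exact ⟨m, hm, (hiff m).1 hm⟩
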